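/- **Setting.** Let $\mathcal X$ be a finite domain, let hypotheses be functions $h:\mathcal X\to\{\pm1\}$, and for a distribution $\mathcal D$ on $\mathcal X\times\{\pm1\}$ put $\mathcal L_{\mathcal D}(h)=\Pr_{(x,y)\sim\mathcal D}[h(x)\ne y]$. A distribution $\mathcal D$ is *realizable* by a class $\mathcal H$ if $\mathcal L_{\mathcal D}(h)=0$ for some $h\in\mathcal H$. A *$\gamma$-weak learner* for $\mathcal H$ is a (measurable) oracle $\mathcal W$ that answers each query distribution $\mathcal D'$ on $\mathcal X\times\{\pm1\}$ by some $h\in\mathcal H$ with $\mathcal L_{\mathcal D'}(h)\le\frac12-\gamma$, and that may declare failure only if no such $h\in\mathcal H$ exists. A *boosting algorithm with $m$ samples and parallel complexity $(p,t)$* is a (measurable) randomized algorithm which does not know $\mathcal H$ or $\mathcal D$. It receives a sample $S$ of $m$ labelled points, interacts with $\mathcal W$ for $p$ rounds, sending in each round at most $t$ distributions supported on $S$, which may depend on $S$, on its internal randomness and on the answers of the earlier rounds, and finally outputs a hypothesis $\mathcal A^{\mathcal W}(S)$, not necessarily in $\mathcal H$. **Theorem.** For every $\gamma_0<\frac12$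 there are constants $c_{\mathrm{lb}},C,\varepsilon>0$, depending only on $\gamma_0$, such that the following holds for all $0<\gamma\le\gamma_0$, all integers $d,m\ge1$, $p,t\ge 0$, every domain $\mathcal X$ of size $2m$, and every boosting algorithm $\mathcal A$ on $\mathcal X$ with $m$ samples and parallel complexity $(p,t)$. 1. If $p\le\min\left(\frac{c_{\mathrm{lb}}d}{\gamma^2},\exp(c_{\mathrm{lb}}d)\right)$ and $t\le\exp(c_{\mathrm{lb}}d)$, then there are a hypothesis class $\mathcal H\subseteq\{\pm1\}^{\mathcal X}$ of VC dimension $\min(\lfloor d/c_{\mathrm{lb}}\rfloor,2m)$, a distribution $\mathcal D$ on $\mathcal X\times\{\pm1\}$ realizable by $\mathcal H$, and a $\gamma$-weak learner $\mathcal W$ for $\mathcal H$ such that $$\mathop{\mathbf E}_{S\sim\mathcal D^m,\ \mathcal A}\left[\mathcal L_{\mathcal D}(\mathcal A^{\mathcal W}(S))\right]\ \ge\ \exp\left(-C\,(p\gamma^2+1)\right).$$ 2. Consequently, if $p,t\ge1$ and the expected loss of $\mathcal A$ is less than $\varepsilon$ for every class $\mathcal H$ of VC dimension $\min(\lfloor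 d/c_{\mathrm{lb}}\rfloor,2m)$, every $\mathcal D$ realizable by $\mathcal H$ and every $\gamma$-weak learner for $\mathcal H$, then $p\ge c_{\mathrm{lb}}/\gamma^2$ (many rounds) or $p\,t\ge\exp(c_{\mathrm{lb}}d)$ (many weak-learner calls in total). -/

import Mathlib

open MeasureTheory

noncomputable section

namespace Boosting

/-- A hypothesis on the domain `X`; the label `true` stands for `+1` and `false` for `-1`. -/
abbrev Hypothesis (X : Type) := X → Bool

/-- A probability distribution on labelled points `X × {±1}`, given by its vector of masses.
It carries the Borel structure inherited from `X × Bool → ℝ`. -/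
abbrev LabelledDist (X : Type) [Fintype X] := stdSimplex ℝ (X × Bool)

variable {X : Type} [Fintype X]

/-- The loss `Pr_{(x, y) ∼ D} [h x ≠ y]`. -/
def loss (D : LabelledDist X) (h : Hypothesis X) : ℝ :=
  ∑ z : X × Bool, if h z.1 ≠ z.2 then D z else 0

/-- Vapnik-Chervonenkis dimension of a hypothesis class, each hypothesis being identified with
the set of points that it labels `+1`. -/
def classVCDim [DecidableEq X] (H : Finset (Hypothesis X)) : ℕ :=
  (H.image fun h => Finset.univ.filter fun x => h x = true).vcDim

/-- `D` is realizable by the class `H`. -/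
def Realizable (H : Finset (Hypothesis X)) (D : LabelledDist X) : Prop :=
  ∃ h ∈ H, loss D h = 0

/-- The oracle interface of a weak learner; the answer `none` means that it declares failure. -/
abbrev Oracle (X : Type) [Fintype X] := LabelledDist X → Option (Hypothesis X)

/-- `W` is a `γ`-weak learner for `H`: every hypothesis it returns is in `H` and has loss at most
`1/2 - γ` on the query, and it declares failure only if no hypothesis of `H` does.
Measurability makes the expectation over a randomized query meaningful. -/
structure IsWeakLearner (γ : ℝ) (H : Finset (Hypothesis X)) (W : Oracle X) : Prop where
  measurable : ∀ a : Option (Hypothesis X), MeasurableSet (W ⁻¹' {a})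
  correct : ∀ D h, W D = some h → h ∈ H ∧ loss D h ≤ 1 / 2 - γ
  failure : ∀ D, W D = none → ∀ h ∈ H, 1 / 2 - γ < loss D h

/-- What a boosting algorithm has been told by the weak learner so far: the answers to the `t`
parallel queries of each past round, oldest round first. -/
abbrev History (X : Type) (t : ℕ) := List (Fin t → Option (Hypothesis X))

/-- A randomized boosting algorithm on the domain `X` with `m` samples and parallel complexity
`(p, t)`. Its random seed is drawn once from the probability space `(Ω, P)`. In each of the `p`
rounds it chooses, from the sample, the answers of the earlier rounds and the seed, `t`
distributions on the sample, given as distributions on the sample indices. (Fewer rounds or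
queries are covered by padding with queries whose answers are ignored.) After the last round it
outputs an arbitrary hypothesis. The hypothesis class and the target distribution are not part of
its input. -/
structure Algorithm (X : Type) (m p t : ℕ) where
  Ω : Type
  [mΩ : MeasurableSpace Ω]
  P : Measure Ω
  [isProb : IsProbabilityMeasure P]
  query : (Fin m → X × Bool) → History X t → Fin t → Ω → stdSimplex ℝ (Fin m)
  output : (Fin m → X × Bool) → History X t → Ω → Hypothesis X
  measurable_query : ∀ S a q, Measurable (query S a q)
  measurable_output : ∀ S a, Measurable (output S a)

attribute [instance] Algorithm.mΩ Algorithm.isProb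

namespace Algorithm

variable {m p t : ℕ}

/-- The answers received in the first `k` rounds of interaction with the oracle `W`. In each round
the queried distribution on labelled points is the image, under the sample `S`, of the chosen
distribution on indices. -/
def history (A : Algorithm X m p t) (W : Oracle X) (S : Fin m → X × Bool) (ω : A.Ω) :
    ℕ → History X t
  | 0 => []
  | k + 1 => A.history W S ω k ++
      [fun q => W (stdSimplex.map S (A.query S (A.history W S ω k) q ω))]

/-- The output of the algorithm after `p` rounds of interaction with `W`, on sample `S`. -/
def run (A : Algorithm X m p t) (W : Oracle X) (S : Fin m → X × Bool) (ω : A.Ω) : Hypothesis X :=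
  A.output S (A.history W S ω p) ω

/-- The expected loss of the output, over `S ∼ D^m` and the internal randomness. -/
def expectedLoss (A : Algorithm X m p t) (W : Oracle X) (D : LabelledDist X) : ℝ :=
  ∑ S : Fin m → X × Bool, (∏ i, D (S i)) * ∫ ω, loss D (A.run W S ω) ∂A.P

end Algorithm

end Boosting

end

/-! The hard instance is random. The concept `c` is uniform on a domain of `2m` points, so at least
`m` points escape the sample. Round `k` gets its own group of `N` hypotheses `c xor e_k xor v_j`:
one error pattern `e_k` of rate `β = 1/2 - ηγ`, shared by the group, and independent noise patterns
`v_j` of constant rate `ρ`. The weak learner scans the groups in order and returns the first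
hypothesis that is good enough.

Little is revealed. As long as the queries of round `k` are answered within groups `0, …, k`, all
that the algorithm learns about an unsampled point `x` goes through the bits `c x xor e_k x`, which
are at most `p` coins of bias `ηγ`. Flipping `c x` together with all `e_k x` changes nothing that it
sees (`groupHyps_flip`, `groupRun_flip`). The overlap of the two coin laws is at least `(4β(1-β))^p
/ 2 = exp(-O(pγ² + 1))` (`le_sum_min_flip`), and this bounds the error at `x` from below
(`le_sum_prediction_error`).

Answers do come from these groups. A query of round `k` is independent of group `k`
(`sum_prod_mul_le_of_resample`), so it suffices that a fresh group beats any fixed weight vector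
with probability `1 - exp(-Ω(d))` (`sum_group_failure_le`). The shared errors alone cannot do this
when the weight sits on few points; the noise repairs it. The weights are split into few heavy
points and light ones of small energy (`exists_heavy_light_split`). Forcing `v` to equal `e` on the
heavy points and tilting it towards `e` on the light ones reaches loss `1/2 - γ`, and Cauchy-Schwarz
shows that untilted noise does so with probability `exp(-O(d))` (`IsSplit.exp_le_noise_prob`). Hence
`N = exp(O(d))` copies suffice.

A union bound over the `pt` queries makes failures negligible. The class has at most `pN + 1 =
exp(O(d))` relevant members, hence VC dimension `O(d)`, and is then enlarged to the exact dimension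
required; the additional hypotheses come last in the oracle's list. Averaging over the random
instance fixes one bad instance (`exists_le_expectedLoss`). -/

namespace Boosting

/-! ### VC dimension of small classes and of their extensions. -/

section VCDimension

variable {X : Type} [Fintype X] [DecidableEq X]

/-- Adding one set to a family raises its VC dimension by at most one. -/
lemma vcDim_insert_le {α : Type*} [DecidableEq α] (a : Finset α) (F : Finset (Finset α)) :
    (insert a F).vcDim ≤ F.vcDim + 1 := by
  refine Finset.sup_le fun s hs => ?_
  rw [Finset.mem_shatterer] at hs
  rcases s.eq_empty_or_nonempty with rfl | ⟨x, hx⟩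
  · simp
  · have hsh : F.Shatters (s.erase x) := by
      intro t ht
      have hxt : x ∉ t := fun h => Finset.notMem_erase x s (ht h)
      obtain ⟨u, hu, hut⟩ := hs (ht.trans (Finset.erase_subset x s))
      obtain ⟨u', hu', hut'⟩ := hs (t := insert x t)
        (Finset.insert_subset hx (ht.trans (Finset.erase_subset x s)))
      have key : ∀ v, s ∩ v = t ∨ s ∩ v = insert x t → s.erase x ∩ v = t := by
        intro v hv
        rw [Finset.erase_inter]
        rcases hv with hv | hv <;> rw [hv]
        · exact Finset.erase_eq_of_notMem hxt
        · exact Finset.erase_insert hxt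
      rw [Finset.mem_insert] at hu hu'
      rcases hu with rfl | hu
      · rcases hu' with rfl | hu'
        · exact absurd (hut.symm.trans hut' ▸ Finset.mem_insert_self x t) hxt
        · exact ⟨u', hu', key u' (Or.inr hut')⟩
      · exact ⟨u, hu, key u (Or.inl hut)⟩
    have := hsh.card_le_vcDim
    rw [Finset.card_erase_of_mem hx] at this
    omega

lemma two_pow_vcDim_le_card {α : Type*} [DecidableEq α] {F : Finset (Finset α)}
    (hF : F.Nonempty) : 2 ^ F.vcDim ≤ F.card := by
  obtain ⟨s, hs, hcard⟩ := Finset.exists_mem_eq_sup F.shatterer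
    ⟨∅, Finset.mem_shatterer.2 (Finset.shatters_empty.2 hF)⟩ Finset.card
  rw [Finset.mem_shatterer, Finset.shatters_iff] at hs
  rw [Finset.vcDim, hcard, ← Finset.card_powerset, ← hs]
  exact Finset.card_image_le

lemma classVCDim_insert_le (h : Hypothesis X) (H : Finset (Hypothesis X)) :
    classVCDim (insert h H) ≤ classVCDim H + 1 := by
  unfold classVCDim
  rw [Finset.image_insert]
  exact vcDim_insert_le _ _

lemma classVCDim_le_card_domain (H : Finset (Hypothesis X)) :
    classVCDim H ≤ Fintype.card X :=
  Finset.sup_le fun s _ => Finset.card_le_univ s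

lemma classVCDim_univ :
    classVCDim (Finset.univ : Finset (Hypothesis X)) = Fintype.card X := by
  refine le_antisymm (classVCDim_le_card_domain _) ?_
  have hsh : ((Finset.univ : Finset (Hypothesis X)).image
      fun h => Finset.univ.filter fun x => h x = true).Shatters Finset.univ := by
    refine Finset.shatters_of_forall_subset fun t _ => ?_
    exact Finset.mem_image.2 ⟨fun x => decide (x ∈ t), Finset.mem_univ _, by ext; simp⟩
  exact hsh.card_le_vcDim

lemma two_pow_classVCDim_le_card {H : Finset (Hypothesis X)} (hH : H.Nonempty) :
    2 ^ classVCDim H ≤ H.card :=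
  (two_pow_vcDim_le_card (hH.image _)).trans Finset.card_image_le

/-- A class extends to one of any prescribed larger VC dimension up to the domain size. -/
lemma exists_superset_classVCDim_eq (H₀ : Finset (Hypothesis X)) {v : ℕ}
    (h₀ : classVCDim H₀ ≤ v) (hv : v ≤ Fintype.card X) :
    ∃ H, H₀ ⊆ H ∧ classVCDim H = v := by
  -- A largest admissible class has dimension exactly `v`: otherwise one more hypothesis would fit,
  -- as it costs at most one dimension.
  obtain ⟨H, hH, hmax⟩ := Finset.exists_max_image
    (Finset.univ.filter fun H : Finset (Hypothesis X) => H₀ ⊆ H ∧ classVCDim H ≤ v)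
    Finset.card ⟨H₀, by simp [h₀]⟩
  simp only [Finset.mem_filter, Finset.mem_univ, true_and] at hH hmax
  refine ⟨H, hH.1, le_antisymm hH.2 ?_⟩
  by_contra! hlt
  have hne : H ≠ Finset.univ := by
    rintro rfl
    rw [classVCDim_univ] at hlt
    omega
  obtain ⟨h, hh⟩ : ∃ h, h ∉ H := by
    by_contra! hall
    exact hne (Finset.eq_univ_iff_forall.2 hall)
  have := hmax (insert h H) ⟨hH.1.trans (Finset.subset_insert h H),
    (classVCDim_insert_le h H).trans hlt⟩
  rw [Finset.card_insert_of_notMem hh] at this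
  omega

end VCDimension

/-! ### Concentration, change of measure and weight splitting for product laws. -/

section ProductBernoulli

variable {ι : Type*} [Fintype ι] [DecidableEq ι]

lemma sum_prod_apply {κ : Type*} [Fintype κ] (f : ι → κ → ℝ) :
    ∑ y : ι → κ, ∏ x, f x (y x) = ∏ x, ∑ b, f x b := by
  rw [Finset.prod_univ_sum, Fintype.piFinset_univ]

/-- Symmetrization: multiplying by the transform of an independent copy at `-z`, which is at least 1
by `1 + s ≤ exp s`, leaves a mixture of `1` and `cosh z`. -/
lemma exp_centered_bernoulli_le {q z : ℝ} (hq0 : 0 ≤ q) (hq1 : q ≤ 1) :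
    q * Real.exp (z * (1 - q)) + (1 - q) * Real.exp (z * (0 - q)) ≤ Real.exp (z ^ 2 / 2) := by
  have h1 : 1 ≤ q * Real.exp (-(z * (1 - q))) + (1 - q) * Real.exp (-(z * (0 - q))) := by
    have a1 := Real.add_one_le_exp (-(z * (1 - q)))
    have a2 := Real.add_one_le_exp (-(z * (0 - q)))
    have b1 := mul_le_mul_of_nonneg_left a1 hq0
    have b2 := mul_le_mul_of_nonneg_left a2 (sub_nonneg.2 hq1)
    nlinarith
  have h0 : 0 ≤ q * Real.exp (z * (1 - q)) + (1 - q) * Real.exp (z * (0 - q)) := by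
    have : 0 ≤ 1 - q := sub_nonneg.2 hq1
    positivity
  refine (le_mul_of_one_le_right h0 h1).trans (le_trans (b := Real.cosh z) ?_
    (Real.cosh_le_exp_half_sq z))
  have e1 : Real.exp (z * (1 - q)) * Real.exp (-(z * (1 - q))) = 1 := by
    rw [← Real.exp_add]; simp
  have e2 : Real.exp (z * (0 - q)) * Real.exp (-(z * (0 - q))) = 1 := by
    rw [← Real.exp_add]; simp
  have e3 : Real.exp (z * (1 - q)) * Real.exp (-(z * (0 - q))) = Real.exp z := by
    rw [← Real.exp_add]; ring_nf
  have e4 : Real.exp (z * (0 - q)) * Real.exp (-(z * (1 - q))) = Real.exp (-z) := by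
    rw [← Real.exp_add]; ring_nf
  have hc : Real.exp z + Real.exp (-z) = 2 * Real.cosh z := by rw [Real.cosh_eq]; ring
  calc _ = q ^ 2 * (Real.exp (z * (1 - q)) * Real.exp (-(z * (1 - q))))
        + (1 - q) ^ 2 * (Real.exp (z * (0 - q)) * Real.exp (-(z * (0 - q))))
        + q * (1 - q) * (Real.exp (z * (1 - q)) * Real.exp (-(z * (0 - q)))
          + Real.exp (z * (0 - q)) * Real.exp (-(z * (1 - q)))) := by ring
    _ = q ^ 2 + (1 - q) ^ 2 + q * (1 - q) * (2 * Real.cosh z) := by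
        rw [e1, e2, e3, e4, hc]; ring
    _ ≤ Real.cosh z := by
        have hcosh := Real.one_le_cosh z
        nlinarith [mul_nonneg (mul_nonneg hq0 (sub_nonneg.2 hq1)) (sub_nonneg.2 hcosh),
          mul_nonneg (sub_nonneg.2 hcosh) (sq_nonneg (2 * q - 1)),
          mul_nonneg (sub_nonneg.2 hcosh) (sq_nonneg q),
          mul_nonneg (sub_nonneg.2 hcosh) (sq_nonneg (1 - q))]

/-- Chernoff-Hoeffding bound for a weighted count of disagreements with a fixed pattern `c`, under
a product distribution on `ι → Bool` with marginals `q`. -/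
lemma sum_disagreement_tail_le {q : ι → Bool → ℝ} (hq0 : ∀ x b, 0 ≤ q x b)
    (hq1 : ∀ x, q x true + q x false = 1) (c : ι → Bool) (w : ι → ℝ) {u θ : ℝ} (hu : 0 ≤ u) :
    ∑ y : ι → Bool, (if θ ≤ ∑ x, w x * ((if y x ≠ c x then 1 else 0) - q x (!c x))
      then ∏ x, q x (y x) else 0) ≤ Real.exp (u ^ 2 / 2 * ∑ x, w x ^ 2 - u * θ) := by
  -- Exponential Markov inequality: the indicator of `θ ≤ S` is at most `exp (u (S - θ))`, which
  -- factorizes over the points.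
  have hstep : ∀ y : ι → Bool,
      (if θ ≤ ∑ x, w x * ((if y x ≠ c x then 1 else 0) - q x (!c x))
        then ∏ x, q x (y x) else 0) ≤ Real.exp (-(u * θ)) * ∏ x, (q x (y x) *
          Real.exp (u * w x * ((if y x ≠ c x then 1 else 0) - q x (!c x)))) := by
    intro y
    have hp : 0 ≤ ∏ x, q x (y x) := Finset.prod_nonneg fun x _ => hq0 x _
    rw [Finset.prod_mul_distrib, ← Real.exp_sum, mul_left_comm, ← Real.exp_add]
    split_ifs with h
    · refine le_mul_of_one_le_right hp (Real.one_le_exp ?_)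
      simp_rw [mul_assoc, ← Finset.mul_sum]
      nlinarith
    · positivity
  refine (Finset.sum_le_sum fun y _ => hstep y).trans ?_
  rw [← Finset.mul_sum,
    sum_prod_apply fun x b => q x b * Real.exp (u * w x * ((if b ≠ c x then 1 else 0) - q x (!c x)))]
  have hprod : ∏ x, ∑ b, q x b * Real.exp (u * w x * ((if b ≠ c x then 1 else 0) - q x (!c x)))
      ≤ ∏ x, Real.exp ((u * w x) ^ 2 / 2) := by
    refine Finset.prod_le_prod (fun x _ => Finset.sum_nonneg fun b _ =>
      mul_nonneg (hq0 x b) (Real.exp_pos _).le) fun x _ => ?_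
    have h01 : q x (c x) = 1 - q x (!c x) := by
      have := hq1 x
      cases c x <;> simp <;> linarith
    have hle : q x (!c x) ≤ 1 := by linarith [hq0 x (c x)]
    have := exp_centered_bernoulli_le (z := u * w x) (hq0 x (!c x)) hle
    refine le_trans (le_of_eq ?_) this
    rw [Fintype.sum_bool]
    cases hc : c x <;> rw [hc] at h01 <;> simp [add_comm, h01]
  calc _ ≤ Real.exp (-(u * θ)) * ∏ x, Real.exp ((u * w x) ^ 2 / 2) :=
        mul_le_mul_of_nonneg_left hprod (Real.exp_pos _).le
    _ = _ := by
        rw [← Real.exp_sum, ← Real.exp_add]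
        congr 1
        rw [Finset.mul_sum, add_comm, sub_eq_add_neg]
        congr 1
        exact Finset.sum_congr rfl fun x _ => by ring

/-- Change of measure between product distributions: an event of probability `Q` under the
marginals `q` has probability at least `Q² / ∏ ∑ q² / r` under the marginals `r`. -/
lemma sq_sum_prod_le {q r : ι → Bool → ℝ} (hr : ∀ x b, 0 < r x b) (P : (ι → Bool) → Prop)
    [DecidablePred P] :
    (∑ y : ι → Bool, if P y then ∏ x, q x (y x) else 0) ^ 2 ≤
      (∑ y : ι → Bool, if P y then ∏ x, r x (y x) else 0) *
        ∏ x, ∑ b, q x b ^ 2 / r x b := by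
  rw [← sum_prod_apply fun x b => q x b ^ 2 / r x b]
  refine Finset.sum_sq_le_sum_mul_sum_of_sq_le_mul _ (fun y _ => ?_) (fun y _ => ?_)
    (fun y _ => ?_)
  · split_ifs
    · exact Finset.prod_nonneg fun x _ => (hr x _).le
    · exact le_rfl
  · exact Finset.prod_nonneg fun x _ => div_nonneg (sq_nonneg _) (hr x _).le
  · split_ifs
    · rw [← Finset.prod_mul_distrib, ← Finset.prod_pow]
      refine le_of_eq (Finset.prod_congr rfl fun x _ => ?_)
      rw [mul_div_cancel₀ _ (hr x _).ne']
    · simp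

/-- A weight vector splits, at a suitable level `l`, into a heavy part `T` and a light remainder
such that the number of heavy points and the normalized energy of the light ones balance. -/
lemma exists_heavy_light_split (w : ι → ℝ) (hw0 : ∀ x, 0 ≤ w x) (hw1 : ∑ x, w x = 1)
    {R : ℝ} (hR : 1 ≤ R) :
    ∃ (T : Finset ι) (l : ℝ), 0 < l ∧ (∀ x ∉ T, w x ≤ l) ∧
      (T.card : ℝ) + (∑ x ∈ Tᶜ, w x ^ 2) / l ^ 2 ≤ R ∧
      l * R ≤ ∑ x ∈ T, w x + (∑ x ∈ Tᶜ, w x ^ 2) / l := by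
  set supp : Finset ι := Finset.univ.filter fun x => 0 < w x with hsupp
  have hzero : ∀ x ∉ supp, w x = 0 := fun x hx =>
    le_antisymm (by simpa [hsupp] using hx) (hw0 x)
  have hsuppsum : ∑ x ∈ supp, w x = 1 := by
    rw [← hw1]
    exact Finset.sum_subset (Finset.subset_univ _) fun x _ hx => hzero x hx
  have hR0 : 0 < R := by linarith
  -- With at most `R` support points all of them may be heavy, and nothing light remains. Otherwise
  -- the level is found by continuity.
  by_cases hcard : (supp.card : ℝ) ≤ R
  · have hV : ∑ x ∈ suppᶜ, w x ^ 2 = 0 :=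
      Finset.sum_eq_zero fun x hx => by rw [hzero x (by simpa using hx)]; simp
    refine ⟨supp, 1 / R, by positivity, fun x hx => by rw [hzero x hx]; positivity, ?_, ?_⟩
    · simpa [hV] using hcard
    · rw [hV, hsuppsum]; field_simp; simp
  · push Not at hcard
    have hne : supp.Nonempty := by
      rw [Finset.nonempty_iff_ne_empty]; intro h
      rw [h] at hsuppsum; simp at hsuppsum
    obtain ⟨x₀, hx₀, hmin⟩ := Finset.exists_min_image supp w hne
    have hwx₀ : 0 < w x₀ := by simpa [hsupp] using hx₀
    have hle1 : ∀ x, w x ≤ 1 := fun x => by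
      rw [← hw1]; exact Finset.single_le_sum (fun y _ => hw0 y) (Finset.mem_univ x)
    -- A zero of `f` is a level at which the energy truncated at `l` equals `R l²`, which turns the
    -- size bound into an equality. Having more than `R` support points makes `f` nonnegative at the
    -- smallest positive weight.
    let f : ℝ → ℝ := fun l => ∑ x, min l (w x) ^ 2 - R * l ^ 2
    have hf : ContinuousOn f (Set.Icc (w x₀) 1) := by
      apply Continuous.continuousOn
      fun_prop
    have hfa : 0 ≤ f (w x₀) := by
      have : ∑ x ∈ supp, min (w x₀) (w x) ^ 2 ≤ ∑ x, min (w x₀) (w x) ^ 2 :=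
        Finset.sum_le_sum_of_subset_of_nonneg (Finset.subset_univ _) fun _ _ _ => sq_nonneg _
      rw [Finset.sum_congr rfl (fun x hx => by rw [min_eq_left (hmin x hx)]),
        Finset.sum_const, nsmul_eq_mul] at this
      have := mul_le_mul_of_nonneg_right hcard.le (sq_nonneg (w x₀))
      simp only [f]; linarith
    have hfb : f 1 ≤ 0 := by
      have : ∑ x, min 1 (w x) ^ 2 ≤ ∑ x, w x := by
        refine Finset.sum_le_sum fun x _ => ?_
        rw [min_eq_right (hle1 x)]
        nlinarith [hw0 x, hle1 x]
      simp only [f]; linarith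
    obtain ⟨l, hl, hfl⟩ := intermediate_value_Icc' (hle1 x₀) hf ⟨hfb, hfa⟩
    have hl0 : 0 < l := hwx₀.trans_le hl.1
    set T : Finset ι := Finset.univ.filter fun x => l < w x with hT
    have hsplit : ∑ x, min l (w x) ^ 2 = T.card * l ^ 2 + ∑ x ∈ Tᶜ, w x ^ 2 := by
      rw [← Finset.sum_add_sum_compl T]
      congr 1
      · rw [← nsmul_eq_mul, ← Finset.sum_const]
        refine Finset.sum_congr rfl fun x hx => ?_
        rw [min_eq_left (by simpa [hT] using (Finset.mem_filter.1 hx).2.le)]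
      · refine Finset.sum_congr rfl fun x hx => ?_
        rw [min_eq_right (by simpa [hT] using hx)]
    have hbal : T.card * l ^ 2 + ∑ x ∈ Tᶜ, w x ^ 2 = R * l ^ 2 := by
      simp only [f] at hfl; linarith
    have hTsum : T.card * l ≤ ∑ x ∈ T, w x := by
      rw [← nsmul_eq_mul, ← Finset.sum_const]
      exact Finset.sum_le_sum fun x hx => (Finset.mem_filter.1 hx).2.le
    refine ⟨T, l, hl0, fun x hx => by simpa [hT] using hx, le_of_eq ?_, ?_⟩
    · field_simp; linarith
    · have : l * R = T.card * l + (∑ x ∈ Tᶜ, w x ^ 2) / l := by field_simp; linarith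
      linarith

end ProductBernoulli

/-! ### Independent bits of a common bias. -/

section Bernoulli

variable {ι : Type*} [Fintype ι]

/-- Mass function of a bit that is `true` with probability `r`. -/
noncomputable def bern (r : ℝ) (b : Bool) : ℝ := if b then r else 1 - r

/-- Mass function of a family of independent bits, each `true` with probability `r`. -/
noncomputable def bernProd (r : ℝ) (e : ι → Bool) : ℝ := ∏ x, bern r (e x)

lemma bern_nonneg {r : ℝ} (h0 : 0 ≤ r) (h1 : r ≤ 1) (b : Bool) : 0 ≤ bern r b := by
  cases b <;> simp [bern, h0, h1]

lemma bern_add (r : ℝ) : bern r true + bern r false = 1 := by simp [bern]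

lemma bern_add_not (r : ℝ) (b : Bool) : bern r b + bern r (!b) = 1 := by
  cases b <;> simp [bern]

lemma bern_mul_not (r : ℝ) (b : Bool) : bern r b * bern r (!b) = r * (1 - r) := by
  cases b <;> simp [bern, mul_comm]

lemma bernProd_nonneg {r : ℝ} (h0 : 0 ≤ r) (h1 : r ≤ 1) (e : ι → Bool) : 0 ≤ bernProd r e :=
  Finset.prod_nonneg fun _ _ => bern_nonneg h0 h1 _

lemma sum_bernProd [DecidableEq ι] (r : ℝ) : ∑ e : ι → Bool, bernProd r e = 1 := by
  unfold bernProd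
  rw [sum_prod_apply fun _ => bern r]
  simp [bern]

/-- Loss of the noisy pattern `v` against the error pattern `e`, weighted by `w`. -/
noncomputable def disagreement (w : ι → ℝ) (v e : ι → Bool) : ℝ :=
  ∑ x, w x * if v x ≠ e x then 1 else 0

end Bernoulli

/-! ### Tilting the noise towards an error pattern. -/

section Tilt

variable {ι : Type*} [DecidableEq ι]

/-- The noise marginals conditioned to agree with `e` on the heavy set `T` and tilted towards `e`
by `η` elsewhere. -/
noncomputable def tilted (ρ : ℝ) (T : Finset ι) (η : ι → ℝ) (e : ι → Bool) (x : ι) (b : Bool) : ℝ :=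
  if x ∈ T then (if b = e x then 1 else 0)
  else if b = e x then bern ρ (e x) + η x else bern ρ (!e x) - η x

lemma tilted_sum (ρ : ℝ) (T : Finset ι) (η : ι → ℝ) (e : ι → Bool) (x : ι) :
    tilted ρ T η e x true + tilted ρ T η e x false = 1 := by
  have := bern_add ρ
  unfold tilted
  by_cases hx : x ∈ T <;> cases e x <;> simp [hx] <;> linarith

lemma tilted_nonneg {ρ : ℝ} (h0 : 0 ≤ ρ) (h1 : ρ ≤ 1 / 2) (T : Finset ι) {η : ι → ℝ}
    (hη0 : ∀ x ∉ T, 0 ≤ η x) (hη1 : ∀ x ∉ T, η x ≤ ρ) (e : ι → Bool) (x : ι) (b : Bool) :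
    0 ≤ tilted ρ T η e x b := by
  unfold tilted
  by_cases hx : x ∈ T
  · simp only [hx, if_true]; split_ifs <;> norm_num
  · have a0 := hη0 x hx
    have a1 := hη1 x hx
    simp only [hx, if_false]
    split_ifs
    · have := bern_nonneg h0 (by linarith) (e x); linarith
    · cases e x <;> simp [bern] <;> linarith

/-- The chi-square factor of one point in the change of measure. A heavy point pays the inverse
probability of the forced bit; on a light point the linear terms cancel, leaving `1 + (ρ t)² / (ρ (1
- ρ))`, and `ρ ≤ 1 / 2` gives `ρ / (1 - ρ) ≤ 1`. -/
lemma tilted_cost_le {ρ : ℝ} (h0 : 0 < ρ) (h1 : ρ ≤ 1 / 2) (T : Finset ι) (t : ι → ℝ)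
    (e : ι → Bool) (x : ι) :
    ∑ b, tilted ρ T (fun x => ρ * t x) e x b ^ 2 / bern ρ b ≤
      if x ∈ T then 1 / ρ else Real.exp (t x ^ 2) := by
  have hpos : ∀ b, 0 < bern ρ b := fun b => by cases b <;> simp [bern] <;> linarith
  have hflip : ∀ f : Bool → ℝ, ∑ b, f b = f (e x) + f (!e x) := fun f => by
    rw [Fintype.sum_bool]; cases e x <;> simp [add_comm]
  have hne : (!e x) ≠ e x := by cases e x <;> simp
  rw [hflip]
  by_cases hx : x ∈ T
  · have : ρ ≤ bern ρ (e x) := by cases e x <;> simp [bern]; linarith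
    simp only [tilted, hx, if_true, if_neg hne, one_pow, ne_eq, OfNat.ofNat_ne_zero,
      not_false_eq_true, zero_pow, zero_div, add_zero]
    exact one_div_le_one_div_of_le h0 this
  · simp only [tilted, hx, if_false, if_true, if_neg hne]
    have hA := hpos (e x)
    have hB := hpos (!e x)
    have hsum := bern_add_not ρ (e x)
    have hmul := bern_mul_not ρ (e x)
    have hid : (bern ρ (e x) + ρ * t x) ^ 2 / bern ρ (e x)
        + (bern ρ (!e x) - ρ * t x) ^ 2 / bern ρ (!e x)
        = 1 + (ρ * t x) ^ 2 / (bern ρ (e x) * bern ρ (!e x)) := by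
      generalize bern ρ (e x) = A at *
      generalize bern ρ (!e x) = B at *
      obtain rfl : B = 1 - A := by linarith
      have hA' := hA.ne'
      have hB' := hB.ne'
      field_simp
      ring
    rw [hid, hmul]
    have : (ρ * t x) ^ 2 / (ρ * (1 - ρ)) ≤ t x ^ 2 := by
      have h3 : 0 < ρ * (1 - ρ) := mul_pos h0 (by linarith)
      rw [div_le_iff₀ h3]
      nlinarith [mul_nonneg (mul_nonneg h0.le (sq_nonneg (t x))) (by linarith : 0 ≤ 1 - 2 * ρ)]
    linarith [Real.add_one_le_exp (t x ^ 2)]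

end Tilt

/-! ### A random group defeats any fixed weight vector. -/

section HeavyLight

variable {ι : Type*} [Fintype ι] [DecidableEq ι]

/-- The data of a heavy-light split at scale `R`. -/
structure IsSplit (w : ι → ℝ) (R : ℝ) (T : Finset ι) (l : ℝ) : Prop where
  nonneg : ∀ x, 0 ≤ w x
  total : ∑ x, w x = 1
  pos : 0 < l
  light : ∀ x ∉ T, w x ≤ l
  size : (T.card : ℝ) + (∑ x ∈ Tᶜ, w x ^ 2) / l ^ 2 ≤ R
  gain : l * R ≤ ∑ x ∈ T, w x + (∑ x ∈ Tᶜ, w x ^ 2) / l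

/-- The part of a weight vector outside `T`. -/
def lightPart (w : ι → ℝ) (T : Finset ι) (x : ι) : ℝ := if x ∈ T then 0 else w x

lemma sum_lightPart (w f : ι → ℝ) (T : Finset ι) :
    ∑ x, lightPart w T x * f x = ∑ x ∈ Tᶜ, w x * f x := by
  rw [← Finset.sum_add_sum_compl T, Finset.sum_eq_zero, zero_add]
  · exact Finset.sum_congr rfl fun x hx => by simp [lightPart, Finset.mem_compl.1 hx]
  · exact fun x hx => by simp [lightPart, hx]

lemma sum_lightPart_sq (w : ι → ℝ) (T : Finset ι) :
    ∑ x, lightPart w T x ^ 2 = ∑ x ∈ Tᶜ, w x ^ 2 := by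
  simp_rw [sq]
  rw [sum_lightPart]
  exact Finset.sum_congr rfl fun x hx => by simp [lightPart, Finset.mem_compl.1 hx]

lemma IsSplit.sum_sq_le {w : ι → ℝ} {R l : ℝ} {T : Finset ι} (h : IsSplit w R T l) :
    ∑ x, lightPart w T x ^ 2 ≤ R * l ^ 2 := by
  rw [sum_lightPart_sq]
  have h1 : (∑ x ∈ Tᶜ, w x ^ 2) / l ^ 2 ≤ R := by
    have := h.size
    have h2 : (0 : ℝ) ≤ T.card := Nat.cast_nonneg _
    linarith
  rwa [div_le_iff₀ (pow_pos h.pos 2)] at h1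

/-- A light weight vector rarely sees an excess of disagreements. -/
lemma IsSplit.tail_le {w : ι → ℝ} {R l : ℝ} {T : Finset ι} (h : IsSplit w R T l)
    {ρ : ℝ} (hρ : 0 < ρ) {q : ι → Bool → ℝ} (hq0 : ∀ x b, 0 ≤ q x b)
    (hq1 : ∀ x, q x true + q x false = 1) (c : ι → Bool) :
    ∑ y : ι → Bool, (if ρ * l * R / 2 ≤
        ∑ x, lightPart w T x * ((if y x ≠ c x then 1 else 0) - q x (!c x))
      then ∏ x, q x (y x) else 0) ≤ Real.exp (-(ρ ^ 2 * R / 8)) := by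
  have hl := h.pos
  -- This `u` minimizes `u² R l² / 2 - u ρ l R / 2`.
  refine (sum_disagreement_tail_le hq0 hq1 c (lightPart w T) (u := ρ / (2 * l))
    (by positivity)).trans (Real.exp_le_exp.2 ?_)
  have h1 := mul_le_mul_of_nonneg_left h.sum_sq_le
    (by positivity : 0 ≤ (ρ / (2 * l)) ^ 2 / 2)
  have h2 : (ρ / (2 * l)) ^ 2 / 2 * (R * l ^ 2) = ρ ^ 2 * R / 8 := by field_simp; ring
  have h3 : ρ / (2 * l) * (ρ * l * R / 2) = ρ ^ 2 * R / 4 := by field_simp; ring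
  linarith

/-- Conditioned on a typical error pattern `e`, the noise is not too unlikely to bring the loss
below `1 / 2 - γ`. -/
lemma IsSplit.exp_le_noise_prob {w : ι → ℝ} {R l : ℝ} {T : Finset ι} (h : IsSplit w R T l)
    {ρ Λ β γ : ℝ} (hρ : ρ = Real.exp (-Λ)) (hΛ : 1 ≤ Λ) (hρ2 : ρ ≤ 1 / 2) (hργ : ρ ≤ 1 / 2 - γ)
    (hβ : ρ + (1 - 2 * ρ) * β ≤ 1 / 2 - γ) (hR : 8 ≤ ρ ^ 2 * R) {e : ι → Bool}
    (he : ∑ x, lightPart w T x * ((if e x ≠ false then 1 else 0) - β) < ρ * l * R / 2) :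
    Real.exp (-(Λ * R)) / 4 ≤
      ∑ v : ι → Bool, if disagreement w v e ≤ 1 / 2 - γ then bernProd ρ v else 0 := by
  have hρ0 : 0 < ρ := hρ ▸ Real.exp_pos _
  have hl := h.pos
  set t : ι → ℝ := fun x => w x / l with ht
  set q := tilted ρ T (fun x => ρ * t x) e with hq
  have ht0 : ∀ x ∉ T, 0 ≤ ρ * t x := fun x _ =>
    mul_nonneg hρ0.le (div_nonneg (h.nonneg x) hl.le)
  have ht1 : ∀ x ∉ T, ρ * t x ≤ ρ := fun x hx =>
    mul_le_of_le_one_right hρ0.le ((div_le_one hl).2 (h.light x hx))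
  have hq0 : ∀ x b, 0 ≤ q x b := tilted_nonneg hρ0.le hρ2 T ht0 ht1 e
  have hq1 : ∀ x, q x true + q x false = 1 := tilted_sum ρ T _ e
  have htail := h.tail_le hρ0 hq0 hq1 e
  have htail' : Real.exp (-(ρ ^ 2 * R / 8)) ≤ 1 / 2 := by
    refine (Real.exp_le_exp.2 (by linarith : -(ρ ^ 2 * R / 8) ≤ -1)).trans ?_
    rw [Real.exp_neg, inv_eq_one_div]
    have := Real.add_one_le_exp 1
    exact one_div_le_one_div_of_le (by norm_num) (by linarith)
  have htot : ∑ y : ι → Bool, ∏ x, q x (y x) = 1 := by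
    rw [sum_prod_apply]
    exact Finset.prod_eq_one fun x _ => by rw [Fintype.sum_bool, hq1]
  -- off the tail event, the tilted distribution reaches the required loss
  have hQ : 1 / 2 ≤ ∑ v : ι → Bool,
      if disagreement w v e ≤ 1 / 2 - γ then ∏ x, q x (v x) else 0 := by
    have hle : ∑ y : ι → Bool, ∏ x, q x (y x) ≤
        ∑ y : ι → Bool, ((if ρ * l * R / 2 ≤
          ∑ x, lightPart w T x * ((if y x ≠ e x then 1 else 0) - q x (!e x))
          then ∏ x, q x (y x) else 0) +
          if disagreement w y e ≤ 1 / 2 - γ then ∏ x, q x (y x) else 0) := by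
      refine Finset.sum_le_sum fun y _ => ?_
      have hy0 : 0 ≤ ∏ x, q x (y x) := Finset.prod_nonneg fun x _ => hq0 x _
      -- The tilted law gives no mass to patterns that differ from `e` on a heavy point.
      by_cases hT : ∀ x ∈ T, y x = e x
      swap
      · push Not at hT
        obtain ⟨x, hx, hne⟩ := hT
        have : ∏ x, q x (y x) = 0 :=
          Finset.prod_eq_zero (Finset.mem_univ x) (by simp [hq, tilted, hx, hne])
        simp [this]
      by_cases ha : ρ * l * R / 2 ≤
          ∑ x, lightPart w T x * ((if y x ≠ e x then 1 else 0) - q x (!e x))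
      · rw [if_pos ha]
        split_ifs <;> linarith
      · rw [if_neg ha, if_pos, zero_add]
        push Not at ha
        rw [sum_lightPart] at ha he
        have hdis : disagreement w y e = ∑ x ∈ Tᶜ, w x * if y x ≠ e x then 1 else 0 := by
          unfold disagreement
          rw [← Finset.sum_add_sum_compl T, Finset.sum_eq_zero, zero_add]
          exact fun x hx => by simp [hT x hx]
        have hqe : ∀ x ∈ Tᶜ, q x (!e x) =
            ρ + (1 - 2 * ρ) * (if e x ≠ false then 1 else 0) - ρ * (w x / l) := by
          intro x hx
          have hx' : x ∉ T := Finset.mem_compl.1 hx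
          cases hex : e x <;> simp [hq, tilted, hx', hex, bern, ht]; ring
        have h1 : ∑ x ∈ Tᶜ, w x * ((if y x ≠ e x then 1 else 0) - q x (!e x)) =
            disagreement w y e - ∑ x ∈ Tᶜ, w x * q x (!e x) := by
          rw [hdis, ← Finset.sum_sub_distrib]
          exact Finset.sum_congr rfl fun x _ => by ring
        have h2 : ∑ x ∈ Tᶜ, w x * q x (!e x) =
            (ρ + (1 - 2 * ρ) * β) * ∑ x ∈ Tᶜ, w x
            + (1 - 2 * ρ) * ∑ x ∈ Tᶜ, w x * ((if e x ≠ false then 1 else 0) - β)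
            - ρ * ((∑ x ∈ Tᶜ, w x ^ 2) / l) := by
          rw [Finset.mul_sum, Finset.mul_sum, Finset.sum_div, Finset.mul_sum,
            ← Finset.sum_add_distrib, ← Finset.sum_sub_distrib]
          exact Finset.sum_congr rfl fun x hx => by rw [hqe x hx]; ring
        have hM : ∑ x ∈ T, w x + ∑ x ∈ Tᶜ, w x = 1 := by
          rw [Finset.sum_add_sum_compl, h.total]
        have hM0 : 0 ≤ ∑ x ∈ T, w x := Finset.sum_nonneg fun x _ => h.nonneg x
        have hM1 : 0 ≤ ∑ x ∈ Tᶜ, w x := Finset.sum_nonneg fun x _ => h.nonneg x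
        -- Agreement on `T` and the tilt outside it save at least `ρ l R` in total; the fluctuations
        -- of `e` and of `y` each consume at most half of it.
        have hgain := mul_le_mul_of_nonneg_left h.gain hρ0.le
        have h3 := mul_le_mul_of_nonneg_right hβ hM1
        have h4 := mul_le_mul_of_nonneg_right hργ hM0
        have hR0 : 0 ≤ R := by
          by_contra! hneg
          nlinarith [sq_nonneg ρ]
        have h5 : (1 - 2 * ρ) * ∑ x ∈ Tᶜ, w x * ((if e x ≠ false then 1 else 0) - β)
            ≤ ρ * l * R / 2 := by
          have hp : 0 ≤ ρ * l * R / 2 := by positivity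
          rcases le_total 0 (∑ x ∈ Tᶜ, w x * ((if e x ≠ false then 1 else 0) - β)) with hs | hs
          · nlinarith
          · nlinarith [mul_nonneg (by linarith : 0 ≤ 1 - 2 * ρ) (neg_nonneg.2 hs)]
        rw [h1] at ha
        have h6 : (1 / 2 - γ) * ∑ x ∈ T, w x + (1 / 2 - γ) * ∑ x ∈ Tᶜ, w x = 1 / 2 - γ := by
          rw [← mul_add, hM, mul_one]
        nlinarith
    rw [htot, Finset.sum_add_distrib] at hle
    linarith
  -- A heavy point costs `1 / ρ = exp Λ` and a light one at most `exp (Λ t²)`, since `1 ≤ Λ`; the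
  -- exponents add up to `Λ` times the quantity bounded in `IsSplit.size`.
  have hcost : ∏ x, ∑ b, q x b ^ 2 / bern ρ b ≤ Real.exp (Λ * R) := by
    have hpos : ∀ b, 0 < bern ρ b := fun b => by cases b <;> simp [bern] <;> linarith
    calc _ ≤ ∏ x, (if x ∈ T then 1 / ρ else Real.exp (t x ^ 2)) :=
          Finset.prod_le_prod
            (fun x _ => Finset.sum_nonneg fun b _ => div_nonneg (sq_nonneg _) (hpos b).le)
            fun x _ => tilted_cost_le hρ0 hρ2 T t e x
      _ ≤ ∏ x, Real.exp (Λ * if x ∈ T then 1 else t x ^ 2) := by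
          refine Finset.prod_le_prod (fun x _ => ?_) fun x _ => ?_
          · split_ifs <;> positivity
          · split_ifs
            · rw [mul_one, hρ, Real.exp_neg, one_div, inv_inv]
            · exact Real.exp_le_exp.2 (le_mul_of_one_le_left (sq_nonneg _) hΛ)
      _ = Real.exp (Λ * (T.card + (∑ x ∈ Tᶜ, w x ^ 2) / l ^ 2)) := by
          rw [← Real.exp_sum, ← Finset.mul_sum, ← Finset.sum_add_sum_compl T]
          congr 3
          · rw [Finset.sum_congr rfl fun x hx => if_pos hx]; simp
          · rw [Finset.sum_div]
            exact Finset.sum_congr rfl fun x hx => by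
              rw [if_neg (Finset.mem_compl.1 hx), ht, div_pow]
      _ ≤ _ := Real.exp_le_exp.2 (mul_le_mul_of_nonneg_left h.size (by linarith))
  have hcs := sq_sum_prod_le (q := q) (r := fun _ => bern ρ)
    (fun _ b => by cases b <;> simp [bern] <;> linarith)
    (fun v => disagreement w v e ≤ 1 / 2 - γ)
  have hP0 : 0 ≤ ∑ v : ι → Bool, if disagreement w v e ≤ 1 / 2 - γ then bernProd ρ v else 0 :=
    Finset.sum_nonneg fun v _ => by
      split_ifs
      · exact bernProd_nonneg hρ0.le (by linarith) v
      · exact le_rfl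
  have h7 : (1 : ℝ) / 4 ≤ (∑ v : ι → Bool,
      if disagreement w v e ≤ 1 / 2 - γ then bernProd ρ v else 0) * Real.exp (Λ * R) := by
    refine le_trans ?_ (hcs.trans (mul_le_mul_of_nonneg_left hcost hP0))
    nlinarith
  rw [Real.exp_neg, inv_eq_one_div, div_div, div_le_iff₀ (by positivity)]
  linarith

/-- A random group of `N` noisy copies of one random pattern almost surely contains, for any fixed
weights, a member of loss at most `1 / 2 - γ`. -/
lemma sum_group_failure_le {w : ι → ℝ} (hw0 : ∀ x, 0 ≤ w x) (hw1 : ∑ x, w x = 1)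
    {ρ Λ β γ R : ℝ} (hρ : ρ = Real.exp (-Λ)) (hΛ : 1 ≤ Λ) (hρ2 : ρ ≤ 1 / 2)
    (hργ : ρ ≤ 1 / 2 - γ) (hβ0 : 0 ≤ β) (hβ1 : β ≤ 1)
    (hβ : ρ + (1 - 2 * ρ) * β ≤ 1 / 2 - γ) (hR1 : 1 ≤ R)
    (hR : 8 ≤ ρ ^ 2 * R) {N : ℕ} (hN : ρ ^ 2 * R / 8 ≤ Real.exp (-(Λ * R)) / 4 * N) :
    ∑ e : ι → Bool, ∑ v : Fin N → ι → Bool, (if ∀ j, 1 / 2 - γ < disagreement w (v j) e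
      then bernProd β e * ∏ j, bernProd ρ (v j) else 0) ≤ 2 * Real.exp (-(ρ ^ 2 * R / 8)) := by
  obtain ⟨T, l, hl, hlight, hsize, hgain⟩ := exists_heavy_light_split w hw0 hw1 hR1
  have hs : IsSplit w R T l := ⟨hw0, hw1, hl, hlight, hsize, hgain⟩
  have hρ0 : 0 < ρ := hρ ▸ Real.exp_pos _
  -- Given `e`, the copies are independent, so the group fails with the `N`-th power of a single
  -- failure probability.
  have hinner : ∀ e : ι → Bool, ∑ v : Fin N → ι → Bool,
      (if ∀ j, 1 / 2 - γ < disagreement w (v j) e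
        then bernProd β e * ∏ j, bernProd ρ (v j) else 0) = bernProd β e *
      (1 - ∑ v : ι → Bool, if disagreement w v e ≤ 1 / 2 - γ then bernProd ρ v else 0) ^ N := by
    intro e
    have h1 : 1 - (∑ v : ι → Bool, if disagreement w v e ≤ 1 / 2 - γ then bernProd ρ v else 0)
        = ∑ v : ι → Bool, if 1 / 2 - γ < disagreement w v e then bernProd ρ v else 0 := by
      rw [sub_eq_iff_eq_add, ← Finset.sum_add_distrib]
      refine (sum_bernProd ρ).symm.trans (Finset.sum_congr rfl fun v _ => ?_)
      by_cases hv : disagreement w v e ≤ 1 / 2 - γ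
      · rw [if_pos hv, if_neg (not_lt.2 hv), zero_add]
      · rw [if_neg hv, if_pos (not_le.1 hv), add_zero]
    rw [h1]
    have h2 := sum_prod_apply (ι := Fin N) (κ := ι → Bool)
      fun _ v => if 1 / 2 - γ < disagreement w v e then bernProd ρ v else 0
    rw [Finset.prod_const, Finset.card_univ, Fintype.card_fin] at h2
    rw [← h2, Finset.mul_sum]
    refine Finset.sum_congr rfl fun v _ => ?_
    rw [Finset.prod_ite_zero]
    simp
  simp_rw [hinner]
  have htail := hs.tail_le hρ0 (q := fun _ => bern β) (fun _ => bern_nonneg hβ0 hβ1)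
    (fun _ => bern_add β) (fun _ => false)
  have hstep : ∀ e : ι → Bool, bernProd β e *
      (1 - ∑ v : ι → Bool, if disagreement w v e ≤ 1 / 2 - γ then bernProd ρ v else 0) ^ N ≤
      (if ρ * l * R / 2 ≤ ∑ x, lightPart w T x * ((if e x ≠ false then 1 else 0) - bern β (!false))
        then ∏ x, bern β (e x) else 0) + bernProd β e * Real.exp (-(ρ ^ 2 * R / 8)) := by
    intro e
    have he0 := bernProd_nonneg hβ0 hβ1 e
    have hp0 : 0 ≤ ∑ v : ι → Bool, if disagreement w v e ≤ 1 / 2 - γ then bernProd ρ v else 0 :=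
      Finset.sum_nonneg fun v _ => by
        split_ifs
        · exact bernProd_nonneg hρ0.le (by linarith) v
        · exact le_rfl
    have hp1 : ∑ v : ι → Bool, (if disagreement w v e ≤ 1 / 2 - γ then bernProd ρ v else 0) ≤ 1 := by
      refine (Finset.sum_le_sum fun v _ => ?_).trans (sum_bernProd ρ).le
      split_ifs
      · exact le_rfl
      · exact bernProd_nonneg hρ0.le (by linarith) v
    -- An atypical `e` is charged to its tail bound. For a typical one, `(1 - s) ^ N ≤ exp (-s N)`
    -- with `s = exp (-(Λ R)) / 4`.
    by_cases hgood : ρ * l * R / 2 ≤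
        ∑ x, lightPart w T x * ((if e x ≠ false then 1 else 0) - bern β (!false))
    · rw [if_pos hgood, ← bernProd]
      have : (1 - ∑ v : ι → Bool,
          if disagreement w v e ≤ 1 / 2 - γ then bernProd ρ v else 0) ^ N ≤ 1 :=
        pow_le_one₀ (by linarith) (by linarith)
      have h1 := mul_le_mul_of_nonneg_left this he0
      have h2 := mul_nonneg he0 (Real.exp_pos (-(ρ ^ 2 * R / 8))).le
      linarith
    · rw [if_neg hgood, zero_add]
      refine mul_le_mul_of_nonneg_left ?_ he0
      push Not at hgood
      have hq := hs.exp_le_noise_prob hρ hΛ hρ2 hργ hβ hR hgood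
      calc _ ≤ (Real.exp (-(Real.exp (-(Λ * R)) / 4))) ^ N := by
            refine pow_le_pow_left₀ (by linarith) ?_ N
            have := Real.add_one_le_exp (-(Real.exp (-(Λ * R)) / 4))
            linarith
        _ = Real.exp (-(Real.exp (-(Λ * R)) / 4 * N)) := by
            rw [← Real.exp_nat_mul]; congr 1; ring
        _ ≤ _ := Real.exp_le_exp.2 (by linarith)
  refine (Finset.sum_le_sum fun e _ => hstep e).trans ?_
  rw [Finset.sum_add_distrib, ← Finset.sum_mul, sum_bernProd]
  linarith

end HeavyLight

/-! ### The first-match oracle, locality of its answers, measurability. -/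

section WeakLearner

variable {X : Type} [Fintype X]

lemma loss_nonneg (D : LabelledDist X) (h : Hypothesis X) : 0 ≤ loss D h :=
  Finset.sum_nonneg fun z _ => by
    split_ifs
    · exact stdSimplex.zero_le D z
    · exact le_rfl

lemma loss_le_one (D : LabelledDist X) (h : Hypothesis X) : loss D h ≤ 1 := by
  rw [← stdSimplex.sum_eq_one D]
  refine Finset.sum_le_sum fun z _ => ?_
  split_ifs
  · exact le_rfl
  · exact stdSimplex.zero_le D z

lemma measurable_loss (h : Hypothesis X) : Measurable fun D : LabelledDist X => loss D h := by
  unfold loss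
  refine Finset.measurable_sum _ fun z _ => ?_
  split_ifs
  · exact (measurable_pi_apply z).comp measurable_subtype_coe
  · exact measurable_const

/-- The oracle that answers with the first hypothesis of a list having loss at most
`1 / 2 - γ`. -/
noncomputable def firstWeak (γ : ℝ) (l : List (Hypothesis X)) : Oracle X :=
  fun D => l.find? fun h => decide (loss D h ≤ 1 / 2 - γ)

lemma measurableSet_firstWeak (γ : ℝ) (l : List (Hypothesis X)) (a : Option (Hypothesis X)) :
    MeasurableSet (firstWeak γ l ⁻¹' {a}) := by
  induction l with
  | nil => exact MeasurableSet.const (none = a)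
  | cons h l ih =>
    have hle : MeasurableSet {D : LabelledDist X | loss D h ≤ 1 / 2 - γ} :=
      measurableSet_le (measurable_loss h) measurable_const
    have hset : firstWeak γ (h :: l) ⁻¹' {a} =
        ({D | loss D h ≤ 1 / 2 - γ} ∩ {_D | some h = a}) ∪
          ({D | loss D h ≤ 1 / 2 - γ}ᶜ ∩ firstWeak γ l ⁻¹' {a}) := by
      ext D
      by_cases hD : loss D h ≤ 1 / 2 - γ
      · simp only [firstWeak, Set.mem_preimage, Set.mem_singleton_iff, List.find?_cons, hD,
          decide_true, Set.mem_union, Set.mem_inter_iff, Set.mem_ofPred_eq, Set.mem_compl_iff,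
          not_true, false_and, or_false, true_and]
      · simp only [firstWeak, Set.mem_preimage, Set.mem_singleton_iff, List.find?_cons, hD,
          decide_false, Set.mem_union, Set.mem_inter_iff, Set.mem_ofPred_eq, Set.mem_compl_iff,
          not_false_iff, false_and, false_or, true_and]
    rw [hset]
    exact (hle.inter (MeasurableSet.const _)).union (hle.compl.inter ih)

lemma isWeakLearner_firstWeak {γ : ℝ} {H : Finset (Hypothesis X)} {l : List (Hypothesis X)}
    (hl : ∀ h, h ∈ l ↔ h ∈ H) : IsWeakLearner γ H (firstWeak γ l) where
  measurable := measurableSet_firstWeak γ l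
  correct D h hD := ⟨(hl h).1 (List.mem_of_find?_eq_some hD),
    by simpa using List.find?_some hD⟩
  failure D hD h hh := by
    have := List.find?_eq_none.1 hD h ((hl h).2 hh)
    simpa using this

/-- A first match never looks past a successful prefix; this is what conceals the hypotheses placed
later in the list. -/
lemma firstWeak_append_of_exists {γ : ℝ} {l : List (Hypothesis X)} {D : LabelledDist X}
    (h : ∃ h ∈ l, loss D h ≤ 1 / 2 - γ) (l' : List (Hypothesis X)) :
    firstWeak γ (l ++ l') D = firstWeak γ l D := by
  obtain ⟨h, hl, hD⟩ := h
  unfold firstWeak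
  rw [List.find?_append]
  cases hf : l.find? fun h => decide (loss D h ≤ 1 / 2 - γ) with
  | none => exact absurd (List.find?_eq_none.1 hf h hl) (by simpa using hD)
  | some b => rfl

variable {m p t : ℕ}

/-- The interaction in which the queries of round `k` are answered from the hypotheses in
`G 0, …, G k` only. -/
noncomputable def groupHistory (A : Algorithm X m p t) (γ : ℝ) (G : ℕ → List (Hypothesis X))
    (S : Fin m → X × Bool) (ω : A.Ω) : ℕ → History X t
  | 0 => []
  | k + 1 => groupHistory A γ G S ω k ++
      [fun q => firstWeak γ ((List.range (k + 1)).flatMap G)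
        (stdSimplex.map S (A.query S (groupHistory A γ G S ω k) q ω))]

lemma groupHistory_congr (A : Algorithm X m p t) (γ : ℝ) {G G' : ℕ → List (Hypothesis X)}
    (S : Fin m → X × Bool) (ω : A.Ω) {k : ℕ} (h : ∀ i < k, G i = G' i) :
    groupHistory A γ G S ω k = groupHistory A γ G' S ω k := by
  induction k with
  | zero => rfl
  | succ k ih =>
    have hflat : (List.range (k + 1)).flatMap G = (List.range (k + 1)).flatMap G' := by
      rw [List.flatMap_def, List.flatMap_def]
      congr 1
      exact List.map_congr_left fun i hi => h i (List.mem_range.1 hi)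
    simp only [groupHistory]
    rw [ih fun i hi => h i (Nat.lt_succ_of_lt hi), hflat]

/-- The query asked in round `k` of the interaction `groupHistory`. -/
noncomputable def groupQuery (A : Algorithm X m p t) (γ : ℝ) (G : ℕ → List (Hypothesis X))
    (S : Fin m → X × Bool) (ω : A.Ω) (k : ℕ) (q : Fin t) : LabelledDist X :=
  stdSimplex.map S (A.query S (groupHistory A γ G S ω k) q ω)

/-- If each group can answer the queries of its round, the algorithm sees no other hypotheses. -/
lemma history_firstWeak_eq (A : Algorithm X m p t) (γ : ℝ) (G : ℕ → List (Hypothesis X))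
    (l : List (Hypothesis X)) (S : Fin m → X × Bool) (ω : A.Ω)
    (hG : ∀ k < p, ∀ q, ∃ h ∈ G k, loss (groupQuery A γ G S ω k q) h ≤ 1 / 2 - γ) {k : ℕ}
    (hk : k ≤ p) :
    A.history (firstWeak γ ((List.range p).flatMap G ++ l)) S ω k =
      groupHistory A γ G S ω k := by
  induction k with
  | zero => rfl
  | succ k ih =>
    simp only [groupHistory, Algorithm.history]
    rw [ih (by omega)]
    congr 2
    funext q
    obtain ⟨n, rfl⟩ : ∃ n, p = k + 1 + n := ⟨p - (k + 1), by omega⟩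
    rw [List.range_add, List.flatMap_append, List.append_assoc]
    obtain ⟨h, hh, hloss⟩ := hG k (by omega) q
    exact firstWeak_append_of_exists
      ⟨h, List.mem_flatMap.2 ⟨k, List.mem_range.2 (by omega), hh⟩, hloss⟩ _

lemma measurable_map_stdSimplex (S : Fin m → X × Bool) :
    Measurable (stdSimplex.map S : stdSimplex ℝ (Fin m) → LabelledDist X) := by
  exact (stdSimplex.continuous_map S).measurable

/-- Queries are measurable in the seed only for a fixed history. There are countably many histories,
so the event is a countable union over the value of the previous one. -/
lemma measurableSet_history (A : Algorithm X m p t) {W : Oracle X}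
    (hW : ∀ a, MeasurableSet (W ⁻¹' {a})) (S : Fin m → X × Bool) (k : ℕ) (a : History X t) :
    MeasurableSet {ω | A.history W S ω k = a} := by
  induction k generalizing a with
  | zero => exact MeasurableSet.const (([] : History X t) = a)
  | succ k ih =>
    have hset : {ω | A.history W S ω (k + 1) = a} =
        ⋃ (b : History X t) (g : Fin t → Option (Hypothesis X)),
          {ω | A.history W S ω k = b} ∩
            ((⋂ q, {ω | W (stdSimplex.map S (A.query S b q ω)) = g q}) ∩
              {_ω | b ++ [g] = a}) := by
      ext ω
      simp only [Set.mem_ofPred_eq, Set.mem_iUnion, Set.mem_inter_iff, Set.mem_iInter,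
        Algorithm.history]
      constructor
      · exact fun h => ⟨_, _, rfl, fun q => rfl, h⟩
      · rintro ⟨b, g, rfl, hg, h⟩
        rw [← h]
        congr 2
        exact funext hg
    rw [hset]
    refine MeasurableSet.iUnion fun b => MeasurableSet.iUnion fun g => (ih b).inter
      ((MeasurableSet.iInter fun q => ?_).inter (MeasurableSet.const _))
    exact ((measurable_map_stdSimplex S).comp (A.measurable_query S b q)) (hW (g q))

lemma measurable_run (A : Algorithm X m p t) {W : Oracle X}
    (hW : ∀ a, MeasurableSet (W ⁻¹' {a})) (S : Fin m → X × Bool) :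
    Measurable fun ω => A.run W S ω := by
  refine measurable_to_countable' fun h => ?_
  have hset : (fun ω => A.run W S ω) ⁻¹' {h} =
      ⋃ b : History X t, {ω | A.history W S ω p = b} ∩ A.output S b ⁻¹' {h} := by
    ext ω
    simp [Algorithm.run]
  rw [hset]
  exact MeasurableSet.iUnion fun b => (measurableSet_history A hW S p b).inter
    (A.measurable_output S b (measurableSet_singleton h))

lemma integrable_loss_run (A : Algorithm X m p t) {W : Oracle X}
    (hW : ∀ a, MeasurableSet (W ⁻¹' {a})) (D : LabelledDist X) (S : Fin m → X × Bool) :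
    Integrable (fun ω => loss D (A.run W S ω)) A.P := by
  refine Integrable.of_bound (C := 1)
    ((measurable_of_finite (loss D)).comp (measurable_run A hW S)).aestronglyMeasurable
    (Filter.Eventually.of_forall fun ω => ?_)
  rw [Real.norm_eq_abs, abs_of_nonneg (loss_nonneg D _)]
  exact loss_le_one D _

end WeakLearner

/-! ### Independence of a round's queries from its group. -/

section Resampling

/-- Resampling one coordinate of an i.i.d. family that the remaining randomness ignores. -/
lemma sum_prod_mul_le_of_resample {ι κ : Type*} [Fintype ι] [DecidableEq ι] [Fintype κ]
    {μ : κ → ℝ} (hμ0 : ∀ y, 0 ≤ μ y) (hμ1 : ∑ y, μ y = 1) (k : ι) (F : (ι → κ) → κ → ℝ)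
    (hF : ∀ g y, F (Function.update g k y) = F g) {δ : ℝ} (hδ : ∀ g, ∑ y, μ y * F g y ≤ δ) :
    ∑ g : ι → κ, (∏ i, μ (g i)) * F g (g k) ≤ δ := by
  have hM1 : ∑ g : ι → κ, ∏ i, μ (g i) = 1 := by
    rw [sum_prod_apply fun _ => μ]
    exact Finset.prod_eq_one fun _ _ => hμ1
  have hswap : ∀ (g : ι → κ) (y : κ),
      (∏ i, μ (Function.update g k y i)) * μ (g k) = (∏ i, μ (g i)) * μ y := by
    intro g y
    rw [← Finset.mul_prod_erase _ _ (Finset.mem_univ k),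
      ← Finset.mul_prod_erase _ (fun i => μ (g i)) (Finset.mem_univ k),
      Finset.prod_congr rfl (fun i hi => by
        rw [Function.update_of_ne (Finset.ne_of_mem_erase hi)]), Function.update_self]
    ring
  -- Swapping coordinate `k` with an independent fresh copy preserves the joint mass, and `F` does
  -- not notice the swap.
  let σ : (ι → κ) × κ → (ι → κ) × κ := fun z => (Function.update z.1 k z.2, z.1 k)
  have hσ : Function.Involutive σ := fun z => by simp [σ]
  calc ∑ g : ι → κ, (∏ i, μ (g i)) * F g (g k)
      = ∑ z : (ι → κ) × κ, (∏ i, μ (z.1 i)) * μ z.2 * F z.1 (z.1 k) := by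
        rw [Fintype.sum_prod_type]
        refine Finset.sum_congr rfl fun g _ => ?_
        simp only
        rw [← Finset.sum_mul, ← Finset.mul_sum, hμ1, mul_one]
    _ = ∑ z : (ι → κ) × κ, (∏ i, μ (z.1 i)) * μ z.2 * F z.1 z.2 := by
        rw [← Equiv.sum_comp hσ.toPerm]
        refine Finset.sum_congr rfl fun z _ => ?_
        simp only [Function.Involutive.coe_toPerm, σ, hF, Function.update_self, hswap]
    _ = ∑ g : ι → κ, (∏ i, μ (g i)) * ∑ y, μ y * F g y := by
        rw [Fintype.sum_prod_type]
        refine Finset.sum_congr rfl fun g _ => ?_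
        rw [Finset.mul_sum]
        exact Finset.sum_congr rfl fun y _ => mul_assoc _ _ _
    _ ≤ ∑ g : ι → κ, (∏ i, μ (g i)) * δ := Finset.sum_le_sum fun g _ =>
        mul_le_mul_of_nonneg_left (hδ g) (Finset.prod_nonneg fun _ _ => hμ0 _)
    _ = δ := by rw [← Finset.sum_mul, hM1, one_mul]

end Resampling

/-! ### The random groups and the probability that one of them fails. -/

section HardInstance

variable {X : Type} [Fintype X] [DecidableEq X] {m p t N : ℕ}

/-- The randomness of one group of hypotheses: an error pattern and `N` noise patterns. -/
abbrev GroupSeed (X : Type) (N : ℕ) := (X → Bool) × (Fin N → X → Bool)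

/-- Mass function of the randomness of a group: errors of rate `β`, noise of rate `ρ`. -/
noncomputable def seedMass (β ρ : ℝ) (g : GroupSeed X N) : ℝ :=
  bernProd β g.1 * ∏ j, bernProd ρ (g.2 j)

lemma sum_noiseMass (ρ : ℝ) : ∑ v : Fin N → X → Bool, ∏ j, bernProd ρ (v j) = 1 := by
  rw [sum_prod_apply fun _ => bernProd ρ]
  exact Finset.prod_eq_one fun _ _ => sum_bernProd ρ

lemma sum_seedMass (β ρ : ℝ) : ∑ g : GroupSeed X N, seedMass β ρ g = 1 := by
  unfold seedMass
  rw [Fintype.sum_prod_type]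
  simp only
  simp_rw [← Finset.mul_sum, sum_noiseMass, mul_one, sum_bernProd]

omit [DecidableEq X] in
lemma seedMass_nonneg {β ρ : ℝ} (hβ0 : 0 ≤ β) (hβ1 : β ≤ 1) (hρ0 : 0 ≤ ρ) (hρ1 : ρ ≤ 1)
    (g : GroupSeed X N) : 0 ≤ seedMass β ρ g :=
  mul_nonneg (bernProd_nonneg hβ0 hβ1 _) (Finset.prod_nonneg fun _ _ => bernProd_nonneg hρ0 hρ1 _)

/-- The hypotheses of a group: noisy copies of the concept `c` corrupted by the error pattern. -/
def groupHyps (c : X → Bool) (g : GroupSeed X N) : List (Hypothesis X) :=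
  List.ofFn fun j x => xor (xor (c x) (g.1 x)) (g.2 j x)

/-- The groups used in the successive rounds. -/
def groups (c : X → Bool) (g : Fin p → GroupSeed X N) (k : ℕ) : List (Hypothesis X) :=
  if h : k < p then groupHyps c (g ⟨k, h⟩) else []

/-- The sample at the points `xs`, labelled by `c`. -/
def labelled (c : X → Bool) (xs : Fin m → X) (i : Fin m) : X × Bool := (xs i, c (xs i))

lemma map_labelled_not (c : X → Bool) (xs : Fin m → X) (μ : stdSimplex ℝ (Fin m)) (x : X) :
    stdSimplex.map (labelled c xs) μ (x, !c x) = 0 := by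
  rw [stdSimplex.map_coe, FunOnFinite.linearMap_apply_apply]
  refine Finset.sum_eq_zero fun i hi => ?_
  have h := (Finset.mem_filter.1 hi).2
  simp only [labelled, Prod.mk.injEq] at h
  obtain ⟨rfl, h2⟩ := h
  cases hc : c (xs i) <;> simp [hc] at h2

lemma sum_bool_eq (b : Bool) (f : Bool → ℝ) : ∑ a, f a = f b + f (!b) := by
  rw [Fintype.sum_bool]; cases b <;> simp [add_comm]

omit [DecidableEq X] in
lemma loss_eq_of_consistent {D : LabelledDist X} {c : X → Bool} (hD : ∀ x, D (x, !c x) = 0)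
    (h : Hypothesis X) : loss D h = ∑ x, D (x, c x) * if h x ≠ c x then 1 else 0 := by
  unfold loss
  rw [Fintype.sum_prod_type]
  refine Finset.sum_congr rfl fun x _ => ?_
  rw [sum_bool_eq (c x)]
  simp [hD]

/-- A fixed query consistent with `c` is unlikely to defeat a random group. -/
lemma sum_seed_failure_le {β ρ γ δ : ℝ}
    (hgroup : ∀ w : X → ℝ, (∀ x, 0 ≤ w x) → ∑ x, w x = 1 →
      ∑ e : X → Bool, ∑ v : Fin N → X → Bool, (if ∀ j, 1 / 2 - γ < disagreement w (v j) e
        then bernProd β e * ∏ j, bernProd ρ (v j) else 0) ≤ δ)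
    {D : LabelledDist X} {c : X → Bool} (hD : ∀ x, D (x, !c x) = 0) :
    ∑ g : GroupSeed X N, seedMass β ρ g *
      (if ∃ h ∈ groupHyps c g, loss D h ≤ 1 / 2 - γ then 0 else 1) ≤ δ := by
  have hw1 : ∑ x, D (x, c x) = 1 := by
    rw [← stdSimplex.sum_eq_one D, Fintype.sum_prod_type]
    refine Finset.sum_congr rfl fun x _ => ?_
    rw [sum_bool_eq (c x), hD, add_zero]
  refine le_trans (le_of_eq ?_) (hgroup (fun x => D (x, c x)) (fun x => stdSimplex.zero_le D _) hw1)
  rw [Fintype.sum_prod_type]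
  refine Finset.sum_congr rfl fun e _ => Finset.sum_congr rfl fun v _ => ?_
  -- The concept cancels: `c xor e xor v` errs at `x` exactly when `v x ≠ e x`.
  have hloss : ∀ j, loss D (fun x => xor (xor (c x) (e x)) (v j x)) =
      disagreement (fun x => D (x, c x)) (v j) e := by
    intro j
    rw [loss_eq_of_consistent hD]
    refine Finset.sum_congr rfl fun x _ => ?_
    congr 1
    cases c x <;> cases e x <;> cases v j x <;> simp
  have hiff : (∃ h ∈ groupHyps c (e, v), loss D h ≤ 1 / 2 - γ) ↔
      ¬ ∀ j, 1 / 2 - γ < disagreement (fun x => D (x, c x)) (v j) e := by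
    push Not
    simp only [groupHyps, List.mem_ofFn', Set.exists_range_iff, hloss]
  simp only [hiff, ite_not, seedMass, mul_ite, mul_one, mul_zero]

/-- Some query of some round cannot be answered by the group of that round. -/
def GroupsFail (A : Algorithm X m p t) (γ : ℝ) (c : X → Bool) (g : Fin p → GroupSeed X N)
    (xs : Fin m → X) (ω : A.Ω) : Prop :=
  ∃ (k : Fin p) (q : Fin t), ¬ ∃ h ∈ groupHyps c (g k),
    loss (groupQuery A γ (groups c g) (labelled c xs) ω k q) h ≤ 1 / 2 - γ

open Classical in
lemma sum_groupsFail_le {β ρ γ δ : ℝ} (hβ0 : 0 ≤ β) (hβ1 : β ≤ 1) (hρ0 : 0 ≤ ρ) (hρ1 : ρ ≤ 1)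
    (hgroup : ∀ w : X → ℝ, (∀ x, 0 ≤ w x) → ∑ x, w x = 1 →
      ∑ e : X → Bool, ∑ v : Fin N → X → Bool, (if ∀ j, 1 / 2 - γ < disagreement w (v j) e
        then bernProd β e * ∏ j, bernProd ρ (v j) else 0) ≤ δ)
    (A : Algorithm X m p t) (c : X → Bool) (xs : Fin m → X) (ω : A.Ω) :
    ∑ g : Fin p → GroupSeed X N, (∏ k, seedMass β ρ (g k)) *
      (if GroupsFail A γ c g xs ω then 1 else 0) ≤ p * t * δ := by
  have hμ0 := seedMass_nonneg (X := X) (N := N) hβ0 hβ1 hρ0 hρ1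
  let F : Fin p → Fin t → (Fin p → GroupSeed X N) → GroupSeed X N → ℝ := fun k q g y =>
    if ∃ h ∈ groupHyps c y,
      loss (groupQuery A γ (groups c g) (labelled c xs) ω k q) h ≤ 1 / 2 - γ then 0 else 1
  have hF0 : ∀ k q g y, 0 ≤ F k q g y := fun k q g y => by
    simp only [F]; split_ifs <;> norm_num
  have hunion : ∀ g, (if GroupsFail A γ c g xs ω then (1 : ℝ) else 0) ≤
      ∑ k, ∑ q, F k q g (g k) := by
    intro g
    split_ifs with h
    · obtain ⟨k, q, hkq⟩ := h
      calc (1 : ℝ) = F k q g (g k) := by simp only [F]; rw [if_neg hkq]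
        _ ≤ ∑ q, F k q g (g k) := Finset.single_le_sum (f := fun q => F k q g (g k))
            (fun q _ => hF0 k q g (g k)) (Finset.mem_univ q)
        _ ≤ _ := Finset.single_le_sum (f := fun k => ∑ q, F k q g (g k))
            (fun k _ => Finset.sum_nonneg fun q _ => hF0 k q g (g k)) (Finset.mem_univ k)
    · exact Finset.sum_nonneg fun k _ => Finset.sum_nonneg fun q _ => hF0 k q g (g k)
  -- The history before round `k` uses only the groups of index below `k`, so resampling group `k`
  -- leaves its queries unchanged.
  have hFk : ∀ k q g y, F k q (Function.update g k y) = F k q g := by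
    intro k q g y
    have hcongr : groupHistory A γ (groups c (Function.update g k y)) (labelled c xs) ω k =
        groupHistory A γ (groups c g) (labelled c xs) ω k := by
      refine groupHistory_congr A γ _ ω fun i hi => ?_
      have hip : i < p := hi.trans k.2
      have hne : (⟨i, hip⟩ : Fin p) ≠ k := fun h => by
        rw [← h] at hi
        exact lt_irrefl _ hi
      simp only [groups, hip, dif_pos, Function.update_of_ne hne]
    funext y'
    refine if_congr ?_ rfl rfl
    simp only [groupQuery, hcongr]
  calc _ ≤ ∑ g : Fin p → GroupSeed X N, ∑ k, ∑ q,
        (∏ i, seedMass β ρ (g i)) * F k q g (g k) := by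
        refine Finset.sum_le_sum fun g _ => ?_
        simp_rw [← Finset.mul_sum]
        exact mul_le_mul_of_nonneg_left (hunion g) (Finset.prod_nonneg fun k _ => hμ0 _)
    _ = ∑ k, ∑ q, ∑ g : Fin p → GroupSeed X N,
        (∏ i, seedMass β ρ (g i)) * F k q g (g k) := by
        rw [Finset.sum_comm]
        exact Finset.sum_congr rfl fun k _ => Finset.sum_comm
    _ ≤ ∑ _k : Fin p, ∑ _q : Fin t, δ := by
        refine Finset.sum_le_sum fun k _ => Finset.sum_le_sum fun q _ => ?_
        exact sum_prod_mul_le_of_resample hμ0 (sum_seedMass β ρ) k (F k q) (hFk k q)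
          fun g => sum_seed_failure_le hgroup fun x => map_labelled_not c xs _ x
    _ = _ := by simp [mul_assoc]

end HardInstance

/-! ### Guessing a hidden bit from biased coins. -/

section Coin

variable {X : Type} [Fintype X] [DecidableEq X] {p N : ℕ}

/-- Flip the bit at `x`. -/
def flipAt (x : X) (e : X → Bool) : X → Bool := Function.update e x (!e x)

/-- Flip the error bit at `x`. -/
def flipSeed (x : X) (g : GroupSeed X N) : GroupSeed X N := (flipAt x g.1, g.2)

omit [Fintype X] in
lemma flipAt_involutive (x : X) : Function.Involutive (flipAt x) := fun e => by
  simp [flipAt]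

omit [Fintype X] in
lemma flipSeed_involutive (x : X) : Function.Involutive (flipSeed (N := N) x) := fun g => by
  simp [flipSeed, flipAt_involutive x g.1]

-- Both flips enter the hypotheses through one exclusive or and cancel.
omit [Fintype X] in
lemma groupHyps_flip (x : X) (c : X → Bool) (g : GroupSeed X N) :
    groupHyps (flipAt x c) (flipSeed x g) = groupHyps c g := by
  unfold groupHyps
  congr 1
  funext j x'
  by_cases hx : x' = x
  · subst hx; simp [flipAt, flipSeed]
  · simp [flipAt, flipSeed, hx]

/-- A geometric mean of the masses of a seed and of its flip at `x`. -/
noncomputable def meanMass (β ρ : ℝ) (x : X) (g : GroupSeed X N) : ℝ :=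
  (∏ x', if x' = x then √(β * (1 - β)) else bern β (g.1 x')) * ∏ j, bernProd ρ (g.2 j)

lemma sq_meanMass {β : ℝ} (hβ0 : 0 ≤ β) (hβ1 : β ≤ 1) (ρ : ℝ) (x : X) (g : GroupSeed X N) :
    meanMass β ρ x g ^ 2 = seedMass β ρ g * seedMass β ρ (flipSeed x g) := by
  have h : (∏ x', if x' = x then √(β * (1 - β)) else bern β (g.1 x')) ^ 2 =
      bernProd β g.1 * bernProd β (flipAt x g.1) := by
    unfold bernProd
    rw [← Finset.prod_pow, ← Finset.prod_mul_distrib]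
    refine Finset.prod_congr rfl fun x' _ => ?_
    split_ifs with hx
    · subst hx
      rw [Real.sq_sqrt (mul_nonneg hβ0 (by linarith)), flipAt, Function.update_self,
        bern_mul_not]
    · rw [flipAt, Function.update_of_ne hx, sq]
  unfold meanMass seedMass flipSeed
  rw [mul_pow, h]
  ring

/-- The Bhattacharyya coefficient of one round: coordinates other than `x`, and the noise, have the
same law on both sides and sum to 1. -/
lemma sum_meanMass (β ρ : ℝ) (x : X) :
    ∑ g : GroupSeed X N, meanMass β ρ x g = 2 * √(β * (1 - β)) := by
  unfold meanMass
  rw [Fintype.sum_prod_type]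
  simp only
  simp_rw [← Finset.mul_sum, sum_noiseMass, mul_one]
  rw [sum_prod_apply fun x' b => if x' = x then √(β * (1 - β)) else bern β b]
  rw [Finset.prod_eq_single x]
  · simp
  · intro x' _ hx'
    simp [hx', bern]
  · simp

/-- The overlap of `p` biased coins tossed for opposite values of the hidden bit. -/
lemma le_sum_min_flip {β ρ : ℝ} (hβ0 : 0 ≤ β) (hβ1 : β ≤ 1) (hρ0 : 0 ≤ ρ) (hρ1 : ρ ≤ 1) (x : X) :
    (4 * (β * (1 - β))) ^ p / 2 ≤ ∑ g : Fin p → GroupSeed X N,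
      min (∏ k, seedMass β ρ (g k)) (∏ k, seedMass β ρ (flipSeed x (g k))) := by
  set M : (Fin p → GroupSeed X N) → ℝ := fun g => ∏ k, seedMass β ρ (g k) with hM
  set M' : (Fin p → GroupSeed X N) → ℝ := fun g => ∏ k, seedMass β ρ (flipSeed x (g k)) with hM'
  have hμ0 := seedMass_nonneg (X := X) (N := N) hβ0 hβ1 hρ0 hρ1
  have hM0 : ∀ g, 0 ≤ M g := fun g => Finset.prod_nonneg fun k _ => hμ0 _
  have hM0' : ∀ g, 0 ≤ M' g := fun g => Finset.prod_nonneg fun k _ => hμ0 _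
  have hM1 : ∑ g, M g = 1 := by
    simp only [hM]
    rw [sum_prod_apply fun _ => seedMass β ρ]
    exact Finset.prod_eq_one fun _ _ => sum_seedMass β ρ
  have hM1' : ∑ g, M' g = 1 := by
    simp only [hM']
    rw [sum_prod_apply fun _ g => seedMass β ρ (flipSeed x g)]
    refine Finset.prod_eq_one fun _ _ => ?_
    rw [← sum_seedMass (X := X) (N := N) β ρ]
    exact Equiv.sum_comp (flipSeed_involutive x).toPerm (seedMass β ρ)
  -- Cauchy-Schwarz with `min * max = M * M'`: the squared Bhattacharyya coefficient is at most the
  -- overlap times the sum of the maxima, which is at most 2.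
  have hcs := Finset.sum_sq_le_sum_mul_sum_of_sq_le_mul (Finset.univ)
    (r := fun g : Fin p → GroupSeed X N => ∏ k, meanMass β ρ x (g k))
    (f := fun g => min (M g) (M' g)) (g := fun g => max (M g) (M' g))
    (fun g _ => le_min (hM0 g) (hM0' g)) (fun g _ => (hM0 g).trans (le_max_left _ _))
    (fun g _ => by
      rw [min_mul_max, ← Finset.prod_pow]
      simp only [hM, hM']
      rw [← Finset.prod_mul_distrib]
      exact (Finset.prod_congr rfl fun k _ => sq_meanMass hβ0 hβ1 ρ x (g k)).le)
  rw [sum_prod_apply fun _ => meanMass β ρ x, Finset.prod_const, sum_meanMass, Finset.card_univ,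
    Fintype.card_fin, ← pow_mul, mul_comm p 2, pow_mul, mul_pow,
    Real.sq_sqrt (mul_nonneg hβ0 (by linarith))] at hcs
  have hmax : ∑ g, max (M g) (M' g) ≤ 2 := by
    calc _ ≤ ∑ g, (M g + M' g) := Finset.sum_le_sum fun g _ =>
          max_le (by linarith [hM0' g]) (by linarith [hM0 g])
      _ = 2 := by rw [Finset.sum_add_distrib, hM1, hM1']; norm_num
  have hmin : 0 ≤ ∑ g, min (M g) (M' g) :=
    Finset.sum_nonneg fun g _ => le_min (hM0 g) (hM0' g)
  have := mul_le_mul_of_nonneg_left hmax hmin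
  norm_num at hcs ⊢
  linarith

/-- No predictor that is blind to a simultaneous flip of the concept and of the errors at `x` can
guess the concept at `x` reliably. -/
lemma le_sum_prediction_error {β ρ : ℝ} (hβ0 : 0 ≤ β) (hβ1 : β ≤ 1) (hρ0 : 0 ≤ ρ) (hρ1 : ρ ≤ 1)
    (x : X) (f : (X → Bool) → (Fin p → GroupSeed X N) → Bool)
    (hf : ∀ c g, f (flipAt x c) (fun k => flipSeed x (g k)) = f c g) :
    (Fintype.card (X → Bool) : ℝ) * ((4 * (β * (1 - β))) ^ p / 4) ≤
      ∑ c, ∑ g : Fin p → GroupSeed X N,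
        (∏ k, seedMass β ρ (g k)) * if f c g ≠ c x then 1 else 0 := by
  let σ : (X → Bool) × (Fin p → GroupSeed X N) → (X → Bool) × (Fin p → GroupSeed X N) :=
    fun z => (flipAt x z.1, fun k => flipSeed x (z.2 k))
  have hσ : Function.Involutive σ := fun z => by
    simp [σ, flipAt_involutive x z.1, flipSeed_involutive x (z.2 _)]
  let B : (X → Bool) × (Fin p → GroupSeed X N) → ℝ := fun z =>
    (∏ k, seedMass β ρ (z.2 k)) * if f z.1 z.2 ≠ z.1 x then 1 else 0
  have hμ0 := seedMass_nonneg (X := X) (N := N) hβ0 hβ1 hρ0 hρ1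
  -- The prediction agrees at `z` and `σ z` while the true bit differs, so exactly one of the two is
  -- an error.
  have hpair : ∀ z : (X → Bool) × (Fin p → GroupSeed X N),
      min (∏ k, seedMass β ρ (z.2 k)) (∏ k, seedMass β ρ (flipSeed x (z.2 k))) ≤
        B z + B (σ z) := by
    intro z
    have h1 : B (σ z) = (∏ k, seedMass β ρ (flipSeed x (z.2 k))) *
        if f z.1 z.2 ≠ !z.1 x then 1 else 0 := by
      simp only [B, σ, hf]
      simp [flipAt]
    rw [h1]
    simp only [B]
    by_cases hz : f z.1 z.2 = z.1 x
    · have : f z.1 z.2 ≠ !z.1 x := by rw [hz]; cases z.1 x <;> simp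
      rw [if_neg (not_not.2 hz), if_pos this]
      simp
    · have : f z.1 z.2 = !z.1 x := by
        revert hz; cases f z.1 z.2 <;> cases z.1 x <;> simp
      rw [if_pos hz, if_neg (not_not.2 this)]
      simp
  have hsum : ∑ z, B (σ z) = ∑ z, B z := Equiv.sum_comp hσ.toPerm B
  have h2 := Finset.sum_le_sum fun z (_ : z ∈ Finset.univ) => hpair z
  rw [Finset.sum_add_distrib, hsum, Fintype.sum_prod_type] at h2
  simp only [Finset.sum_const, Finset.card_univ, nsmul_eq_mul] at h2
  have h3 := mul_le_mul_of_nonneg_left (le_sum_min_flip (p := p) (N := N) hβ0 hβ1 hρ0 hρ1 x)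
    (Nat.cast_nonneg (α := ℝ) (Fintype.card (X → Bool)))
  rw [Fintype.sum_prod_type] at h2
  simp only [B] at h2
  linarith

end Coin

/-! ### From the random instance to a fixed one. -/

section Averaging

variable {X : Type} [Fintype X] [DecidableEq X] {m p t N : ℕ}

/-- The uniform distribution on the domain, labelled by `c`. -/
noncomputable def graphDist [Nonempty X] (c : X → Bool) : LabelledDist X :=
  ⟨fun z => if z.2 = c z.1 then (Fintype.card X : ℝ)⁻¹ else 0,
    fun z => by dsimp only; split_ifs <;> positivity, by
      rw [Fintype.sum_prod_type]
      simp⟩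

omit [DecidableEq X] in
lemma graphDist_apply [Nonempty X] (c : X → Bool) (z : X × Bool) :
    graphDist c z = if z.2 = c z.1 then (Fintype.card X : ℝ)⁻¹ else 0 := rfl

omit [DecidableEq X] in
lemma loss_graphDist [Nonempty X] (c : X → Bool) (h : Hypothesis X) :
    loss (graphDist c) h = (Fintype.card X : ℝ)⁻¹ * ∑ x, if h x ≠ c x then 1 else 0 := by
  rw [loss_eq_of_consistent (c := c), Finset.mul_sum]
  · simp [graphDist_apply]
  · intro x
    rw [graphDist_apply]
    cases c x <;> simp

omit [DecidableEq X] in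
lemma le_expectedLoss_graphDist [Nonempty X] (A : Algorithm X m p t) (W : Oracle X)
    (c : X → Bool) :
    ((Fintype.card X : ℝ)⁻¹) ^ m *
      ∑ xs : Fin m → X, ∫ ω, loss (graphDist c) (A.run W (labelled c xs) ω) ∂A.P ≤
      A.expectedLoss W (graphDist c) := by
  have hinj : Function.Injective (labelled (m := m) c) := fun xs xs' h => by
    funext i
    exact congrArg Prod.fst (congrFun h i)
  have hterm : ∀ xs : Fin m → X, ∏ i, graphDist c (labelled c xs i) =
      ((Fintype.card X : ℝ)⁻¹) ^ m := by
    intro xs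
    simp [graphDist_apply, labelled]
  unfold Algorithm.expectedLoss
  rw [Finset.mul_sum]
  calc _ = ∑ S ∈ Finset.univ.map ⟨labelled (m := m) c, hinj⟩, (∏ i, graphDist c (S i)) *
        ∫ ω, loss (graphDist c) (A.run W S ω) ∂A.P := by
        rw [Finset.sum_map]
        exact Finset.sum_congr rfl fun xs _ => by simp only [Function.Embedding.coeFn_mk, hterm]
    _ ≤ _ := Finset.sum_le_sum_of_subset_of_nonneg (Finset.subset_univ _) fun S _ _ =>
        mul_nonneg (Finset.prod_nonneg fun i _ => stdSimplex.zero_le _ _)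
          (integral_nonneg fun ω => loss_nonneg _ _)

/-- The output of the algorithm after the interaction `groupHistory`. -/
noncomputable def groupRun (A : Algorithm X m p t) (γ : ℝ) (c : X → Bool)
    (g : Fin p → GroupSeed X N) (xs : Fin m → X) (ω : A.Ω) : Hypothesis X :=
  A.output (labelled c xs) (groupHistory A γ (groups c g) (labelled c xs) ω p) ω

/-- Off the sample, the flip changes neither the labels nor the hypotheses of the groups, so the
entire interaction is the same. -/
lemma groupRun_flip (A : Algorithm X m p t) (γ : ℝ) (c : X → Bool) (g : Fin p → GroupSeed X N)
    (xs : Fin m → X) (ω : A.Ω) {x : X} (hx : ∀ i, xs i ≠ x) :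
    groupRun A γ (flipAt x c) (fun k => flipSeed x (g k)) xs ω = groupRun A γ c g xs ω := by
  have h1 : labelled (flipAt x c) xs = labelled c xs := by
    funext i
    simp [labelled, flipAt, hx i]
  have h2 : groups (flipAt x c) (fun k => flipSeed x (g k)) = groups c g := by
    funext k
    unfold groups
    split_ifs
    · exact groupHyps_flip x c _
    · rfl
  unfold groupRun
  rw [h1, h2]

omit [DecidableEq X] in
lemma run_eq_groupRun (A : Algorithm X m p t) {γ : ℝ} {c : X → Bool} {g : Fin p → GroupSeed X N}
    (l : List (Hypothesis X)) {xs : Fin m → X} {ω : A.Ω} (h : ¬ GroupsFail A γ c g xs ω) :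
    A.run (firstWeak γ ((List.range p).flatMap (groups c g) ++ l)) (labelled c xs) ω =
      groupRun A γ c g xs ω := by
  unfold Algorithm.run groupRun
  rw [history_firstWeak_eq A γ (groups c g) l _ ω (fun k hk q => ?_) le_rfl]
  unfold GroupsFail at h
  push Not at h
  obtain ⟨f, hf, hloss⟩ := h ⟨k, hk⟩ q
  exact ⟨f, by simpa [groups, hk] using hf, hloss⟩

open Classical in
/-- For a fixed sample of points and a fixed seed, the loss averaged over the random instance. -/
lemma le_sum_loss_run [Nonempty X] (hcard : Fintype.card X = 2 * m) (hm : 1 ≤ m)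
    {β ρ γ δ : ℝ} (hβ0 : 0 ≤ β) (hβ1 : β ≤ 1) (hρ0 : 0 ≤ ρ) (hρ1 : ρ ≤ 1)
    (hgroup : ∀ w : X → ℝ, (∀ x, 0 ≤ w x) → ∑ x, w x = 1 →
      ∑ e : X → Bool, ∑ v : Fin N → X → Bool, (if ∀ j, 1 / 2 - γ < disagreement w (v j) e
        then bernProd β e * ∏ j, bernProd ρ (v j) else 0) ≤ δ)
    (hδ : p * t * δ ≤ (4 * (β * (1 - β))) ^ p / 4)
    (A : Algorithm X m p t) (l : (X → Bool) → (Fin p → GroupSeed X N) → List (Hypothesis X))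
    (xs : Fin m → X) (ω : A.Ω) :
    (Fintype.card (X → Bool) : ℝ) * (((4 * (β * (1 - β))) ^ p / 4 - p * t * δ) / 2) ≤
      ∑ c, ∑ g : Fin p → GroupSeed X N, (∏ k, seedMass β ρ (g k)) *
        loss (graphDist c) (A.run (firstWeak γ ((List.range p).flatMap (groups c g) ++ l c g))
          (labelled c xs) ω) := by
  set U : Finset X := (Finset.univ.image xs)ᶜ with hU
  have hUm : (m : ℝ) ≤ U.card := by
    have h1 : (Finset.univ.image xs).card ≤ m := by
      simpa using Finset.card_image_le (s := Finset.univ) (f := xs)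
    have h2 : U.card = 2 * m - (Finset.univ.image xs).card := by
      rw [hU, Finset.card_compl, hcard]
    exact_mod_cast (by omega : m ≤ U.card)
  have hm0 : (0 : ℝ) < m := by exact_mod_cast hm
  have hμ0 := seedMass_nonneg (X := X) (N := N) hβ0 hβ1 hρ0 hρ1
  have hM0 : ∀ g : Fin p → GroupSeed X N, 0 ≤ ∏ k, seedMass β ρ (g k) := fun g =>
    Finset.prod_nonneg fun k _ => hμ0 _
  -- Subtracting the failure indicator makes the left side nonpositive on failure; off failure the
  -- real run coincides with `groupRun`.
  have hpoint : ∀ c (g : Fin p → GroupSeed X N), (2 * m : ℝ)⁻¹ * ∑ x ∈ U,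
      ((if groupRun A γ c g xs ω x ≠ c x then 1 else 0) -
        if GroupsFail A γ c g xs ω then 1 else 0) ≤
      loss (graphDist c) (A.run (firstWeak γ ((List.range p).flatMap (groups c g) ++ l c g))
          (labelled c xs) ω) := by
    intro c g
    by_cases hfail : GroupsFail A γ c g xs ω
    · refine le_trans (mul_nonpos_of_nonneg_of_nonpos (by positivity)
        (Finset.sum_nonpos fun x _ => ?_)) (loss_nonneg _ _)
      rw [if_pos hfail]
      split_ifs <;> norm_num
    · rw [run_eq_groupRun A _ hfail, loss_graphDist, hcard]
      push_cast
      refine mul_le_mul_of_nonneg_left ?_ (by positivity)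
      simp only [if_neg hfail, sub_zero]
      exact Finset.sum_le_sum_of_subset_of_nonneg (Finset.subset_univ _) fun x _ _ => by
        split_ifs <;> norm_num
  have hfail : ∑ c : X → Bool, ∑ g : Fin p → GroupSeed X N, (∏ k, seedMass β ρ (g k)) *
      (if GroupsFail A γ c g xs ω then 1 else 0) ≤ Fintype.card (X → Bool) * (p * t * δ) := by
    rw [← nsmul_eq_mul, ← Finset.card_univ, ← Finset.sum_const]
    exact Finset.sum_le_sum fun c _ => sum_groupsFail_le hβ0 hβ1 hρ0 hρ1 hgroup A c xs ω
  have herr : ∀ x ∈ U, (Fintype.card (X → Bool) : ℝ) * ((4 * (β * (1 - β))) ^ p / 4) ≤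
      ∑ c, ∑ g : Fin p → GroupSeed X N,
        (∏ k, seedMass β ρ (g k)) * if groupRun A γ c g xs ω x ≠ c x then 1 else 0 := by
    intro x hx
    have hx' : ∀ i, xs i ≠ x := by simpa [hU] using hx
    exact le_sum_prediction_error hβ0 hβ1 hρ0 hρ1 x (fun c g => groupRun A γ c g xs ω x)
      fun c g => congrFun (groupRun_flip A γ c g xs ω hx') x
  set E : ℝ := (4 * (β * (1 - β))) ^ p / 4 with hE
  set K : ℝ := ((Fintype.card (X → Bool) : ℕ) : ℝ) with hK
  have hK0 : 0 ≤ K := Nat.cast_nonneg _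
  calc K * ((E - p * t * δ) / 2)
      ≤ (2 * m : ℝ)⁻¹ * ∑ x ∈ U, (K * E - K * (p * t * δ)) := by
        rw [Finset.sum_const, nsmul_eq_mul]
        have h1 : K * ((E - p * t * δ) / 2) =
            (2 * m : ℝ)⁻¹ * (m * (K * E - K * (p * t * δ))) := by field_simp
        rw [h1]
        refine mul_le_mul_of_nonneg_left (mul_le_mul_of_nonneg_right hUm ?_) (by positivity)
        rw [← mul_sub]
        exact mul_nonneg hK0 (by linarith)
    _ ≤ (2 * m : ℝ)⁻¹ * ∑ x ∈ U, ∑ c, ∑ g : Fin p → GroupSeed X N, (∏ k, seedMass β ρ (g k)) *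
        ((if groupRun A γ c g xs ω x ≠ c x then 1 else 0) -
          if GroupsFail A γ c g xs ω then 1 else 0) := by
        refine mul_le_mul_of_nonneg_left (Finset.sum_le_sum fun x hx => ?_) (by positivity)
        simp_rw [mul_sub, Finset.sum_sub_distrib]
        exact sub_le_sub (herr x hx) hfail
    _ = ∑ c, ∑ g : Fin p → GroupSeed X N, (∏ k, seedMass β ρ (g k)) * ((2 * m : ℝ)⁻¹ * ∑ x ∈ U,
        ((if groupRun A γ c g xs ω x ≠ c x then 1 else 0) -
          if GroupsFail A γ c g xs ω then 1 else 0)) := by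
        rw [Finset.sum_comm, Finset.mul_sum]
        refine Finset.sum_congr rfl fun c _ => ?_
        rw [Finset.sum_comm, Finset.mul_sum]
        refine Finset.sum_congr rfl fun g _ => ?_
        rw [← Finset.mul_sum]
        ring
    _ ≤ _ := Finset.sum_le_sum fun c _ => Finset.sum_le_sum fun g _ =>
        mul_le_mul_of_nonneg_left (hpoint c g) (hM0 g)

/-- Some instance is as hard for the algorithm as the random one on average. -/
lemma exists_le_expectedLoss [Nonempty X] (hcard : Fintype.card X = 2 * m) (hm : 1 ≤ m)
    {β ρ γ δ : ℝ} (hβ0 : 0 ≤ β) (hβ1 : β ≤ 1) (hρ0 : 0 ≤ ρ) (hρ1 : ρ ≤ 1)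
    (hgroup : ∀ w : X → ℝ, (∀ x, 0 ≤ w x) → ∑ x, w x = 1 →
      ∑ e : X → Bool, ∑ v : Fin N → X → Bool, (if ∀ j, 1 / 2 - γ < disagreement w (v j) e
        then bernProd β e * ∏ j, bernProd ρ (v j) else 0) ≤ δ)
    (hδ : p * t * δ ≤ (4 * (β * (1 - β))) ^ p / 4)
    (A : Algorithm X m p t) (l : (X → Bool) → (Fin p → GroupSeed X N) → List (Hypothesis X)) :
    ∃ (c : X → Bool) (g : Fin p → GroupSeed X N),
      ((4 * (β * (1 - β))) ^ p / 4 - p * t * δ) / 2 ≤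
        A.expectedLoss (firstWeak γ ((List.range p).flatMap (groups c g) ++ l c g))
          (graphDist c) := by
  set V : ℝ := ((4 * (β * (1 - β))) ^ p / 4 - p * t * δ) / 2 with hV
  set W : (X → Bool) → (Fin p → GroupSeed X N) → Oracle X := fun c g =>
    firstWeak γ ((List.range p).flatMap (groups c g) ++ l c g) with hW
  set M : (Fin p → GroupSeed X N) → ℝ := fun g => ∏ k, seedMass β ρ (g k) with hM
  have hM0 : ∀ g, 0 ≤ M g := fun g =>
    Finset.prod_nonneg fun k _ => seedMass_nonneg hβ0 hβ1 hρ0 hρ1 _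
  have hM1 : ∑ g, M g = 1 := by
    simp only [hM]
    rw [sum_prod_apply fun _ => seedMass β ρ]
    exact Finset.prod_eq_one fun _ _ => sum_seedMass β ρ
  set K : ℝ := ((Fintype.card (X → Bool) : ℕ) : ℝ) with hK
  have hK0 : 0 < K := by rw [hK]; exact_mod_cast Fintype.card_pos
  have hn : (0 : ℝ) < Fintype.card X := by exact_mod_cast Fintype.card_pos
  have hint : ∀ c g xs, Integrable
      (fun ω => loss (graphDist c) (A.run (W c g) (labelled c xs) ω)) A.P := fun c g xs =>
    integrable_loss_run A (measurableSet_firstWeak γ _) _ _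
  have hxs : ∀ xs : Fin m → X, K * V ≤ ∑ c, ∑ g, M g *
      ∫ ω, loss (graphDist c) (A.run (W c g) (labelled c xs) ω) ∂A.P := by
    intro xs
    have hswap : ∑ c, ∑ g, M g * ∫ ω, loss (graphDist c) (A.run (W c g) (labelled c xs) ω) ∂A.P =
        ∫ ω, ∑ c, ∑ g, M g * loss (graphDist c) (A.run (W c g) (labelled c xs) ω) ∂A.P := by
      rw [integral_finsetSum _ fun c _ => integrable_finsetSum _ fun g _ =>
        (hint c g xs).const_mul _]
      refine Finset.sum_congr rfl fun c _ => ?_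
      rw [integral_finsetSum _ fun g _ => (hint c g xs).const_mul _]
      exact Finset.sum_congr rfl fun g _ => (integral_const_mul _ _).symm
    rw [hswap]
    calc K * V = ∫ _ω, K * V ∂A.P := by simp
      _ ≤ _ := integral_mono (integrable_const _)
          (integrable_finsetSum _ fun c _ => integrable_finsetSum _ fun g _ =>
            (hint c g xs).const_mul _)
          fun ω => le_sum_loss_run hcard hm hβ0 hβ1 hρ0 hρ1 hgroup hδ A l xs ω
  have havg : K * V ≤ ∑ c, ∑ g, M g * A.expectedLoss (W c g) (graphDist c) := by
    calc K * V = ((Fintype.card X : ℝ)⁻¹) ^ m * ∑ _xs : Fin m → X, K * V := by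
          rw [Finset.sum_const, Finset.card_univ, Fintype.card_fun, Fintype.card_fin,
            nsmul_eq_mul, Nat.cast_pow, ← mul_assoc, ← mul_pow, inv_mul_cancel₀ hn.ne', one_pow,
            one_mul]
      _ ≤ ((Fintype.card X : ℝ)⁻¹) ^ m * ∑ xs : Fin m → X, ∑ c, ∑ g, M g *
          ∫ ω, loss (graphDist c) (A.run (W c g) (labelled c xs) ω) ∂A.P :=
          mul_le_mul_of_nonneg_left (Finset.sum_le_sum fun xs _ => hxs xs) (by positivity)
      _ = ∑ c, ∑ g, M g * (((Fintype.card X : ℝ)⁻¹) ^ m * ∑ xs : Fin m → X,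
          ∫ ω, loss (graphDist c) (A.run (W c g) (labelled c xs) ω) ∂A.P) := by
          rw [Finset.sum_comm, Finset.mul_sum]
          refine Finset.sum_congr rfl fun c _ => ?_
          rw [Finset.sum_comm, Finset.mul_sum]
          refine Finset.sum_congr rfl fun g _ => ?_
          rw [← Finset.mul_sum]
          ring
      _ ≤ _ := Finset.sum_le_sum fun c _ => Finset.sum_le_sum fun g _ =>
          mul_le_mul_of_nonneg_left (le_expectedLoss_graphDist A (W c g) c) (hM0 g)
  by_contra! hlt
  have hne : (Finset.univ : Finset (Fin p → GroupSeed X N)).Nonempty :=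
    ⟨fun _ => (fun _ => true, fun _ _ => true), Finset.mem_univ _⟩
  obtain ⟨z, -, hz⟩ := Finset.exists_max_image
    (Finset.univ ×ˢ Finset.univ : Finset ((X → Bool) × (Fin p → GroupSeed X N)))
    (fun z => A.expectedLoss (W z.1 z.2) (graphDist z.1))
    (Finset.univ_nonempty.product hne)
  have hle : ∑ c, ∑ g, M g * A.expectedLoss (W c g) (graphDist c) ≤
      K * A.expectedLoss (W z.1 z.2) (graphDist z.1) := by
    rw [hK, ← nsmul_eq_mul, ← Finset.card_univ, ← Finset.sum_const]
    refine Finset.sum_le_sum fun c _ => ?_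
    calc _ ≤ ∑ g, M g * A.expectedLoss (W z.1 z.2) (graphDist z.1) :=
          Finset.sum_le_sum fun g _ => mul_le_mul_of_nonneg_left
            (hz (c, g) (by simp)) (hM0 g)
      _ = _ := by rw [← Finset.sum_mul, hM1, one_mul]
  have := mul_lt_mul_of_pos_left (hlt z.1 z.2) hK0
  linarith

omit [Fintype X] [DecidableEq X] in
lemma length_flatMap_groups_le (c : X → Bool) (g : Fin p → GroupSeed X N) (n : ℕ) :
    ((List.range n).flatMap (groups c g)).length ≤ n * N := by
  induction n with
  | zero => simp
  | succ n ih =>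
    rw [List.range_succ, List.flatMap_append, List.length_append, Nat.succ_mul]
    refine Nat.add_le_add ih ?_
    simp only [List.flatMap_cons, List.flatMap_nil, List.append_nil, groups]
    split_ifs <;> simp [groupHyps]

/-- The hard instance, for any group size and failure probability compatible with the target
VC dimension. -/
lemma exists_hard_instance [Nonempty X] (hcard : Fintype.card X = 2 * m) (hm : 1 ≤ m)
    {β ρ γ δ : ℝ} (hβ0 : 0 ≤ β) (hβ1 : β ≤ 1) (hρ0 : 0 ≤ ρ) (hρ1 : ρ ≤ 1)
    (hgroup : ∀ w : X → ℝ, (∀ x, 0 ≤ w x) → ∑ x, w x = 1 →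
      ∑ e : X → Bool, ∑ v : Fin N → X → Bool, (if ∀ j, 1 / 2 - γ < disagreement w (v j) e
        then bernProd β e * ∏ j, bernProd ρ (v j) else 0) ≤ δ)
    (hδ : p * t * δ ≤ (4 * (β * (1 - β))) ^ p / 4) {v : ℕ}
    (hv : ∀ n : ℕ, 2 ^ n ≤ p * N + 1 → n ≤ v) (A : Algorithm X m p t) :
    ∃ (H : Finset (Hypothesis X)) (D : LabelledDist X) (W : Oracle X),
      classVCDim H = min v (2 * m) ∧ Realizable H D ∧ IsWeakLearner γ H W ∧
      ((4 * (β * (1 - β))) ^ p / 4 - p * t * δ) / 2 ≤ A.expectedLoss W D := by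
  have hex : ∀ (c : X → Bool) (g : Fin p → GroupSeed X N), ∃ H : Finset (Hypothesis X),
      insert c ((List.range p).flatMap (groups c g)).toFinset ⊆ H ∧
        classVCDim H = min v (2 * m) := by
    intro c g
    refine exists_superset_classVCDim_eq _ (le_min (hv _ ?_) ?_) (hcard ▸ min_le_right _ _)
    · refine (two_pow_classVCDim_le_card (Finset.insert_nonempty _ _)).trans
        ((Finset.card_insert_le _ _).trans (Nat.succ_le_succ ?_))
      exact (List.toFinset_card_le _).trans (length_flatMap_groups_le c g p)
    · exact hcard ▸ classVCDim_le_card_domain _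
  choose H hsub hvc using hex
  -- Listing all of `H` after the groups makes the oracle complete for `H`, and leaves the answers
  -- unchanged as long as the groups succeed.
  obtain ⟨c, g, hcg⟩ := exists_le_expectedLoss hcard hm hβ0 hβ1 hρ0 hρ1 hgroup hδ A
    fun c g => (H c g).toList
  refine ⟨H c g, graphDist c, _, hvc c g, ⟨c, hsub c g (Finset.mem_insert_self _ _), ?_⟩,
    isWeakLearner_firstWeak fun h => ?_, hcg⟩
  · rw [loss_graphDist]; simp
  · rw [List.mem_append, Finset.mem_toList]
    refine ⟨fun h' => h'.elim (fun h' => hsub c g ?_) id, Or.inr⟩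
    exact Finset.mem_insert_of_mem (List.mem_toFinset.2 h')

end Averaging

/-! ### Numerical estimates for the choice of parameters. -/

section Constants

/-- The success probability of a random group, with all parameters proportional to `d`. -/
lemma sum_group_failure_le_exp {τ γ η : ℝ} (hτ0 : 0 < τ) (hτ1 : τ ≤ 1 / 4) (hγ0 : 0 < γ)
    (hγ : γ ≤ 1 / 2 - τ) (hη : η = (1 - τ) / (1 - 2 * τ)) {d : ℕ} (hd : 1 ≤ d) {N : ℕ}
    (hN : 8 * d ≤ Real.exp (-(Real.log (4 / τ) * (1024 / τ ^ 2 * d))) / 4 * N)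
    {ι : Type*} [Fintype ι] [DecidableEq ι] {w : ι → ℝ} (hw0 : ∀ x, 0 ≤ w x)
    (hw1 : ∑ x, w x = 1) :
    ∑ e : ι → Bool, ∑ v : Fin N → ι → Bool, (if ∀ j, 1 / 2 - γ < disagreement w (v j) e
      then bernProd (1 / 2 - η * γ) e * ∏ j, bernProd (τ / 4) (v j) else 0) ≤
      2 * Real.exp (-(8 * d)) := by
  have hd1 : (1 : ℝ) ≤ d := by exact_mod_cast hd
  have hden : 0 < 1 - 2 * τ := by linarith
  have hη1 : η * (1 - 2 * τ) = 1 - τ := by rw [hη, div_mul_cancel₀ _ hden.ne']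
  have hη0 : 0 < η := hη ▸ div_pos (by linarith) hden
  have hηγ : η * γ ≤ 1 / 2 := by nlinarith [mul_le_mul_of_nonneg_left hγ hη0.le]
  have hρ : τ / 4 = Real.exp (-Real.log (4 / τ)) := by
    rw [Real.exp_neg, Real.exp_log (by positivity), inv_div]
  have hΛ : 1 ≤ Real.log (4 / τ) := by
    rw [Real.le_log_iff_exp_le (by positivity)]
    have : (4 : ℝ) ≤ 4 / τ := by rw [le_div_iff₀ hτ0]; linarith
    linarith [Real.exp_one_lt_d9]
  -- This `R` makes `ρ² R / 8 = 8 d`, the exponent of the failure bound.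
  have hR : (τ / 4) ^ 2 * (1024 / τ ^ 2 * d) = 64 * d := by field_simp; norm_num
  have hR1 : 1 ≤ 1024 / τ ^ 2 * d := by
    have : 1 ≤ 1024 / τ ^ 2 := by rw [le_div_iff₀ (by positivity)]; nlinarith
    nlinarith
  have h := sum_group_failure_le hw0 hw1 (ρ := τ / 4) (β := 1 / 2 - η * γ) (γ := γ)
    (R := 1024 / τ ^ 2 * d) (N := N) hρ hΛ (by linarith) (by linarith) (by linarith)
    (by nlinarith [mul_pos hη0 hγ0]) ?_ hR1 (by rw [hR]; linarith) (by rw [hR]; linarith)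
  · rw [hR] at h
    convert h using 4
    ring
  · have h1 : γ ≤ (1 - 2 * (τ / 4)) * (η * γ) := by
      have h2 : 1 ≤ (1 - 2 * (τ / 4)) * η := by
        rw [hη, ← mul_div_assoc, le_div_iff₀ hden]
        nlinarith
      nlinarith
    linarith

/-- The right side is `1 - u` with `u = (2ηγ)²`. Since `u ≤ 1 - τ`, the bound `1 / (1 - u) ≤ exp (u
/ (1 - u))` loses only a factor `1 / τ` in the exponent. -/
lemma exp_le_four_mul_bias {τ γ η : ℝ} (hτ0 : 0 < τ) (hτ1 : τ ≤ 1 / 4) (hγ0 : 0 < γ)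
    (hγ : γ ≤ 1 / 2 - τ) (hη : η = (1 - τ) / (1 - 2 * τ)) :
    Real.exp (-(16 / τ * γ ^ 2)) ≤ 4 * ((1 / 2 - η * γ) * (1 - (1 / 2 - η * γ))) := by
  have hden : 0 < 1 - 2 * τ := by linarith
  have hη1 : η * (1 - 2 * τ) = 1 - τ := by rw [hη, div_mul_cancel₀ _ hden.ne']
  have hη0 : 0 < η := hη ▸ div_pos (by linarith) hden
  have hη2 : η ≤ 2 := by rw [hη, div_le_iff₀ hden]; linarith
  have ha0 : 0 < η * γ := mul_pos hη0 hγ0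
  have ha : 2 * (η * γ) ≤ 1 - τ := by nlinarith [mul_le_mul_of_nonneg_left hγ hη0.le]
  set u : ℝ := (2 * (η * γ)) ^ 2 with hu
  have hu0 : 0 ≤ u := sq_nonneg _
  have hu1 : u ≤ 1 - τ := by nlinarith
  have hu2 : u ≤ 16 * γ ^ 2 := by
    rw [hu, mul_pow, mul_pow]
    have : η ^ 2 ≤ 4 := by nlinarith
    nlinarith [sq_nonneg γ]
  have h1 : u / (1 - u) ≤ 16 / τ * γ ^ 2 := by
    rw [div_le_iff₀ (by linarith)]
    have : 16 / τ * γ ^ 2 * τ = 16 * γ ^ 2 := by field_simp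
    have h0 : 0 ≤ 16 / τ * γ ^ 2 := by positivity
    nlinarith
  have h2 : 1 / (1 - u) ≤ Real.exp (16 / τ * γ ^ 2) := by
    have h3 : 1 / (1 - u) = u / (1 - u) + 1 := by
      have : 1 - u ≠ 0 := by linarith
      field_simp
      ring
    rw [h3]
    exact (Real.add_one_le_exp _).trans (Real.exp_le_exp.2 h1)
  have h4 : 4 * ((1 / 2 - η * γ) * (1 - (1 / 2 - η * γ))) = 1 - u := by rw [hu]; ring
  rw [h4, Real.exp_neg]
  have h5 := inv_anti₀ (div_pos one_pos (by linarith)) h2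
  rwa [one_div, inv_inv] at h5

lemma two_pow_le_exp (n : ℕ) : (2 : ℝ) ^ n ≤ Real.exp n := by
  rw [← mul_one (n : ℝ), Real.exp_nat_mul]
  exact pow_le_pow_left₀ (by norm_num) (by linarith [Real.add_one_le_exp 1]) n

/-- The class of the hard instance is small enough for its VC dimension to be linear in `d`. -/
lemma le_of_two_pow_le_group_card {d p n : ℕ} (hd : 1 ≤ d) {B : ℝ} (hB : 0 ≤ B)
    (hp : (p : ℝ) ≤ Real.exp d)
    (hn : 2 ^ n ≤ p * ⌈32 * d * Real.exp (B * d)⌉₊ + 1) : (n : ℝ) ≤ 2 * ((35 + B) * d) := by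
  have hd1 : (1 : ℝ) ≤ d := by exact_mod_cast hd
  have hE : 1 ≤ Real.exp (B * d) := Real.one_le_exp (by positivity)
  have hceil : (⌈32 * d * Real.exp (B * d)⌉₊ : ℝ) ≤ Real.exp ((32 + B) * d) := by
    have h1 := (Nat.ceil_lt_add_one (a := 32 * d * Real.exp (B * d)) (by positivity)).le
    have h2 : Real.exp ((32 + B) * d) = Real.exp (32 * d) * Real.exp (B * d) := by
      rw [← Real.exp_add]; ring_nf
    have h3 := mul_le_mul_of_nonneg_right (Real.add_one_le_exp (32 * (d : ℝ)))
      (Real.exp_pos (B * d)).le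
    rw [h2]
    linarith
  have h4 : (2 : ℝ) ^ n ≤ Real.exp d * Real.exp ((32 + B) * d) + 1 := by
    have h5 : (2 : ℝ) ^ n ≤ p * ⌈32 * d * Real.exp (B * d)⌉₊ + 1 := by exact_mod_cast hn
    have h6 := mul_le_mul hp hceil (Nat.cast_nonneg _) (Real.exp_pos _).le
    linarith
  have h7 : Real.exp d * Real.exp ((32 + B) * d) + 1 ≤ Real.exp ((35 + B) * d) := by
    rw [← Real.exp_add]
    have h8 : (35 + B) * d = (d + (32 + B) * d) + 2 * d := by ring
    have h9 : 1 ≤ Real.exp (d + (32 + B) * d) := Real.one_le_exp (by positivity)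
    have h10 := Real.add_one_le_exp (2 * (d : ℝ))
    rw [h8, Real.exp_add _ (2 * (d : ℝ))]
    nlinarith
  have h11 : Real.exp (n / 2) ≤ (2 : ℝ) ^ n := by
    have h12 : Real.exp (1 / 2) ≤ 2 := by
      have h13 : Real.exp (1 / 2) * Real.exp (1 / 2) = Real.exp 1 := by
        rw [← Real.exp_add]; norm_num
      nlinarith [Real.exp_one_lt_d9, Real.exp_pos (1 / 2)]
    have h14 : (n : ℝ) / 2 = n * (1 / 2) := by ring
    rw [h14, Real.exp_nat_mul]
    exact pow_le_pow_left₀ (Real.exp_pos _).le h12 n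
  have := Real.exp_le_exp.1 (h11.trans (h4.trans h7))
  linarith

end Constants

/-! ### The lower bound with explicit constants. -/

/-- The hard instance, with constants depending on `τ = 1 / 2 - γ₀` only. -/
lemma exists_parallel_lower_bound {τ : ℝ} (hτ0 : 0 < τ) (hτ1 : τ ≤ 1 / 4) :
    ∃ c C : ℝ, 0 < c ∧ 0 < C ∧ ∀ γ : ℝ, 0 < γ → γ ≤ 1 / 2 - τ → ∀ d m p t : ℕ, 1 ≤ d → 1 ≤ m →
      ∀ (X : Type) [Fintype X] [DecidableEq X], Fintype.card X = 2 * m →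
        ∀ A : Algorithm X m p t,
          (p : ℝ) ≤ min (c * d / γ ^ 2) (Real.exp (c * d)) → (t : ℝ) ≤ Real.exp (c * d) →
            ∃ (H : Finset (Hypothesis X)) (D : LabelledDist X) (W : Oracle X),
              classVCDim H = min ⌊(d : ℝ) / c⌋₊ (2 * m) ∧
              Realizable H D ∧ IsWeakLearner γ H W ∧
              Real.exp (-(C * (p * γ ^ 2 + 1))) ≤ A.expectedLoss W D := by
  set B : ℝ := Real.log (4 / τ) * (1024 / τ ^ 2) with hB
  have hB0 : 0 ≤ B := by
    refine mul_nonneg (Real.log_nonneg ?_) (by positivity)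
    rw [le_div_iff₀ hτ0]; linarith
  have hC1 : 0 < 16 / τ := by positivity
  -- With `c = 1 / a`, the three summands respectively ensure `c ≤ 1 / 2`, `16 / τ * c ≤ 1`, and
  -- room for the VC dimension of the groups.
  set a : ℝ := 2 + 16 / τ + 2 * (35 + B) with ha
  have ha0 : 0 < a := by positivity
  refine ⟨1 / a, 16 / τ + 4, by positivity, by positivity, ?_⟩
  intro γ hγ0 hγ d m p t hd hm X _ _ hcard A hp ht
  have hd1 : (1 : ℝ) ≤ d := by exact_mod_cast hd
  have hc1 : 1 / a ≤ 1 / 2 := one_div_le_one_div_of_le (by norm_num) (by linarith)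
  have hcC : 16 / τ * (1 / a) ≤ 1 := by
    rw [mul_one_div, div_le_one ha0]; linarith
  have hcd : 1 / a * d ≤ 1 / 2 * d := mul_le_mul_of_nonneg_right hc1 (by linarith)
  have hp1 : (p : ℝ) ≤ Real.exp (1 / 2 * d) :=
    (hp.trans (min_le_right _ _)).trans (Real.exp_le_exp.2 hcd)
  have ht1 : (t : ℝ) ≤ Real.exp (1 / 2 * d) := ht.trans (Real.exp_le_exp.2 hcd)
  have hpγ : 16 / τ * γ ^ 2 * p ≤ d := by
    have h1 := (le_div_iff₀ (pow_pos hγ0 2)).1 (hp.trans (min_le_left _ _))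
    have h2 := mul_le_mul_of_nonneg_left h1 hC1.le
    have h3 := mul_le_mul_of_nonneg_right hcC (by linarith : (0 : ℝ) ≤ d)
    linarith
  have : Nonempty X := Fintype.card_pos_iff.1 (by omega)
  -- Large enough that noise of rate `τ / 4` preserves an advantage `γ`, since `(1 - τ / 2) η ≥ 1`;
  -- small enough that `β = 1 / 2 - η γ ≥ τ / 2`.
  set η : ℝ := (1 - τ) / (1 - 2 * τ) with hη
  have hden : 0 < 1 - 2 * τ := by linarith
  have hη1 : η * (1 - 2 * τ) = 1 - τ := by rw [hη, div_mul_cancel₀ _ hden.ne']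
  have hη0 : 0 < η := div_pos (by linarith) hden
  have hηγ : η * γ ≤ 1 / 2 := by nlinarith [mul_le_mul_of_nonneg_left hγ hη0.le]
  have hηγ0 : 0 < η * γ := mul_pos hη0 hγ0
  set N : ℕ := ⌈32 * d * Real.exp (B * d)⌉₊ with hNdef
  have hN : 8 * d ≤ Real.exp (-(Real.log (4 / τ) * (1024 / τ ^ 2 * d))) / 4 * N := by
    rw [← mul_assoc, ← hB, Real.exp_neg]
    have h1 : 32 * d * Real.exp (B * d) ≤ N := Nat.le_ceil _
    rw [inv_eq_one_div, div_div, div_mul_eq_mul_div, le_div_iff₀ (by positivity)]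
    linarith
  set Q : ℝ := (4 * ((1 / 2 - η * γ) * (1 - (1 / 2 - η * γ)))) ^ p with hQ
  have hQle : Real.exp (-(16 / τ * γ ^ 2 * p)) ≤ Q := by
    have h1 := pow_le_pow_left₀ (Real.exp_pos _).le
      (exp_le_four_mul_bias hτ0 hτ1 hγ0 hγ hη) p
    rw [← Real.exp_nat_mul] at h1
    refine le_trans (le_of_eq ?_) h1
    congr 1
    ring
  -- Here `p t ≤ exp d` and `Q ≥ exp (-d)`, so `exp (-(8 d))` has a factor `exp (-(6 d))` to spare.
  -- What survives is `(Q / 4 - Q / 8) / 2 = Q / 16`, which the summand 4 in the constant `C`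
  -- absorbs.
  have hfail : p * t * (2 * Real.exp (-(8 * d))) ≤ Q / 8 := by
    have h1 : (p : ℝ) * t ≤ Real.exp (1 / 2 * d) * Real.exp (1 / 2 * d) :=
      mul_le_mul hp1 ht1 (Nat.cast_nonneg _) (Real.exp_pos _).le
    have h2 := mul_le_mul_of_nonneg_right h1 (by positivity : 0 ≤ 2 * Real.exp (-(8 * (d : ℝ))))
    have h3 : Real.exp (1 / 2 * d) * Real.exp (1 / 2 * d) * (2 * Real.exp (-(8 * (d : ℝ)))) =
        2 * (Real.exp (-(6 * (d : ℝ))) * Real.exp (-(d : ℝ))) := by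
      rw [← Real.exp_add, mul_left_comm, ← Real.exp_add, ← Real.exp_add]
      ring_nf
    have h4 : Real.exp (-(d : ℝ)) ≤ Q := (Real.exp_le_exp.2 (by linarith)).trans hQle
    have h5 : Real.exp (-(6 * (d : ℝ))) ≤ 1 / 16 := by
      have h6 : (16 : ℝ) ≤ Real.exp 6 := by
        have := two_pow_le_exp 6
        norm_num at this
        linarith
      refine (Real.exp_le_exp.2 (by linarith : -(6 * (d : ℝ)) ≤ -6)).trans ?_
      rw [Real.exp_neg, inv_eq_one_div]
      exact one_div_le_one_div_of_le (by norm_num) h6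
    have h7 := mul_le_mul h5 h4 (Real.exp_pos _).le (by norm_num)
    linarith
  have hQ0 : 0 ≤ Q := (Real.exp_pos _).le.trans hQle
  obtain ⟨H, D, W, hvc, hreal, hweak, hloss⟩ := exists_hard_instance (N := N) hcard hm
    (β := 1 / 2 - η * γ) (ρ := τ / 4) (γ := γ) (δ := 2 * Real.exp (-(8 * d)))
    (by linarith) (by linarith) (by linarith) (by linarith)
    (fun w hw0 hw1 => sum_group_failure_le_exp hτ0 hτ1 hγ0 hγ hη hd hN hw0 hw1)
    (by rw [← hQ]; linarith) (v := ⌊(d : ℝ) / (1 / a)⌋₊)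
    (fun n hn => Nat.le_floor (by
      rw [div_div_eq_mul_div, div_one]
      have h1 := le_of_two_pow_le_group_card hd hB0
        (hp1.trans (Real.exp_le_exp.2 (by linarith))) hn
      nlinarith)) A
  refine ⟨H, D, W, hvc, hreal, hweak, le_trans ?_ hloss⟩
  have h1 : Real.exp (-((16 / τ + 4) * (p * γ ^ 2 + 1))) ≤
      Real.exp (-(16 / τ * γ ^ 2 * p)) * Real.exp (-4) := by
    rw [← Real.exp_add]
    refine Real.exp_le_exp.2 ?_
    have : 0 ≤ (p : ℝ) * γ ^ 2 := by positivity
    nlinarith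
  have h2 : Real.exp (-4) ≤ 1 / 16 := by
    have := two_pow_le_exp 4
    norm_num at this
    rw [Real.exp_neg, inv_eq_one_div]
    exact one_div_le_one_div_of_le (by norm_num) this
  have h3 := mul_le_mul hQle h2 (Real.exp_pos _).le hQ0
  rw [← hQ]
  linarith

end Boosting

/-! ### Both claims of the theorem. -/

theorem theorem3p1 (γ₀ : ℝ) (hγ₀ : γ₀ < 1 / 2) :
    ∃ c C ε : ℝ, 0 < c ∧ 0 < C ∧ 0 < ε ∧
      ∀ (γ : ℝ), 0 < γ → γ ≤ γ₀ → ∀ (d m p t : ℕ), 1 ≤ d → 1 ≤ m →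
        ∀ (X : Type) [Fintype X] [DecidableEq X], Fintype.card X = 2 * m →
          ∀ A : Boosting.Algorithm X m p t,
            -- the hard instance
            ((p : ℝ) ≤ min (c * d / γ ^ 2) (Real.exp (c * d)) → (t : ℝ) ≤ Real.exp (c * d) →
              ∃ (H : Finset (Boosting.Hypothesis X)) (D : Boosting.LabelledDist X)
                (W : Boosting.Oracle X),
                Boosting.classVCDim H = min ⌊(d : ℝ) / c⌋₊ (2 * m) ∧
                Boosting.Realizable H D ∧ Boosting.IsWeakLearner γ H W ∧
                Real.exp (-(C * (p * γ ^ 2 + 1))) ≤ A.expectedLoss W D) ∧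
            -- many rounds, or many calls in total, are needed for a small expected loss
            (1 ≤ p → 1 ≤ t →
              (∀ (H : Finset (Boosting.Hypothesis X)) (D : Boosting.LabelledDist X)
                (W : Boosting.Oracle X),
                Boosting.classVCDim H = min ⌊(d : ℝ) / c⌋₊ (2 * m) →
                Boosting.Realizable H D → Boosting.IsWeakLearner γ H W →
                A.expectedLoss W D < ε) →
              c / γ ^ 2 ≤ (p : ℝ) ∨ Real.exp (c * d) ≤ (p : ℝ) * t) := by
  -- The cap keeps `1 - 2 τ` at least `1 / 2` even when `γ₀` is small or negative.
  set τ : ℝ := min (1 / 2 - γ₀) (1 / 4) with hτ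
  obtain ⟨c, C, hc, hC, hlow⟩ := Boosting.exists_parallel_lower_bound
    (τ := τ) (lt_min (by linarith) (by norm_num)) (min_le_right _ _)
  have hτγ : τ ≤ 1 / 2 - γ₀ := min_le_left _ _
  -- This `ε` is the lower bound of the first claim at `p γ² = c`. If both alternatives fail, then
  -- `p` and `t` are each at most `p t < exp (c d)`, as both are at least 1, so the first claim
  -- applies.
  refine ⟨c, C, Real.exp (-(C * (c + 1))), hc, hC, Real.exp_pos _, ?_⟩
  intro γ hγ0 hγ d m p t hd hm X _ _ hcard A
  have hhard := hlow γ hγ0 (by linarith) d m p t hd hm X hcard A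
  refine ⟨hhard, fun hp ht hsmall => ?_⟩
  by_contra! hcon
  obtain ⟨hrounds, hcalls⟩ := hcon
  have hγ2 : 0 < γ ^ 2 := pow_pos hγ0 2
  have hp1 : (1 : ℝ) ≤ p := by exact_mod_cast hp
  have ht1 : (1 : ℝ) ≤ t := by exact_mod_cast ht
  have hd1 : (1 : ℝ) ≤ d := by exact_mod_cast hd
  obtain ⟨H, D, W, hvc, hreal, hweak, hloss⟩ := hhard
    (le_min (hrounds.le.trans (div_le_div_of_nonneg_right (by nlinarith) hγ2.le))
      (by nlinarith)) (by nlinarith)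
  have hlt := hsmall H D W hvc hreal hweak
  have hle : Real.exp (-(C * (c + 1))) ≤ Real.exp (-(C * (p * γ ^ 2 + 1))) := by
    have := (lt_div_iff₀ hγ2).1 hrounds
    exact Real.exp_le_exp.2 (neg_le_neg (mul_le_mul_of_nonneg_left (by linarith) hC.le))
  linarith
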